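/- Let $A\in\mathbb{R}^{m\times n}$, $b\in\mathbb{R}^m$, and let $p:\mathbb{R}^n\to[0,+\infty]$ be a closed (lower semicontinuous) gauge function, i.e. a nonnegative, positively homogeneous, convex function with $p(0)=0$. Write $p^*$ for its Fenchel conjugate, $\partial p(0)$ for its subdifferential at the origin, $\mathrm{Prox}_p(x):=\arg\min_{z}\{p(z)+\frac12\|z-x\|^2\}$, and $\Pi_C$ for the metric projection onto a nonempty closed convex set $C$. Assume that for every $\lambda>0$ the problem $\min_{x\in\mathbb{R}^n}\{\frac12\|Ax-b\|^2+\lambda p(x)\}$ has a solution; let $x(\lambda)$ be any solution and put $\varphi(\lambda):=\|Ax(\lambda)-b\|$. Let $(y(\lambda),u(\lambda))$ be the (unique) solution of the dual problem $$\max_{y\in\mathbb{R}^m,\,u\in\mathbb{R}^n}\left\{-\tfrac12\|y\|^2+\langle b,y\rangle-\lambda p^*(u)\ \middle|\ A^Ty-\lambda u=0\right\}.$$ Define $\Phi(x):=\frac12\|Ax-b\|^2$ and $$H(x,\lambda):=x-\mathrm{Prox}_p\big(x-\lambda^{-1}\nabla\Phi(x)\big),\qquad (x,\lambda)\in\mathbb{R}^n\times(0,\infty).$$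 For a function $F:O\to\mathcal Y$ that is locally Lipschitz on an open set $O$, let $\partial F(x)$ denote its Clarke generalized Jacobian (the convex hull of all limits of $F'(x^k)$ along sequences $x^k\to x$ of points at which $F$ is differentiable). $F$ is strongly semismooth at $x\in O$ if it is locally Lipschitz on $O$, directionally differentiable at $x$, and $F(x+h)-F(x)-Vh=O(\|h\|^2)$ for all $V\in\partial F(x+h)$ as $h\to0$; it is strongly semismooth on $O$ if it is so at every point of $O$. Let $\partial_xH(x,\lambda)$ be the set of all $V_x\in\mathbb{R}^{n\times n}$ such that $[V_x,V_\lambda]\in\partial H(x,\lambda)$ for some $V_\lambda\in\mathbb{R}^n$; it is nondegenerate if all of its elements are nonsingular. The function $p$ is polyhedral if its epigraph is a polyhedral convex set. A function on $(0,\infty)$ is piecewise affine if it is continuous and at every point agrees with one member of a fixed finite family of affine functions. Then: (i) If $\Pi_{\partial p(0)}$ is strongly semismooth on $\mathbb{R}^n$ and $\partial_xH(\bar x,\bar\lambda)$ is nondegenerate at some $(\bar x,\bar\lambda)\in\mathbb{R}^n\times(0,\infty)$ with $H(\bar x,\bar\lambda)=0$, then $y(\cdot)$ and $\varphi(\cdot)$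 (as functions on $(0,\infty)$) are strongly semismooth at $\bar\lambda$. (ii) If $p$ is in addition polyhedral, then $y(\cdot)$ is piecewise affine on $(0,\infty)$ and $\varphi(\cdot)$ is strongly semismooth on $(0,\infty)$. -/

import Mathlib

open Set Filter Topology

noncomputable section

/-! ### Extended-real-valued convex functions -/

section ConvexAnalysis

variable {E : Type*} [NormedAddCommGroup E] [InnerProductSpace ℝ E]

/-- The epigraph of an extended-real-valued function. -/
def epigraph (p : E → EReal) : Set (E × ℝ) := {z | p z.1 ≤ (z.2 : EReal)}

/-- A gauge function: a nonnegative, positively homogeneous, convex function with `p 0 = 0`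
(the value `+∞` is allowed). -/
structure IsGaugeFunction (p : E → EReal) : Prop where
  nonneg : ∀ x, 0 ≤ p x
  map_zero : p 0 = 0
  pos_homogeneous : ∀ (t : ℝ) (x : E), 0 < t → p (t • x) = (t : EReal) * p x
  convex : Convex ℝ (epigraph p)

/-- A polyhedral convex set: the solution set of a finite system of affine inequalities. -/
def IsPolyhedralSet {V : Type*} [AddCommGroup V] [Module ℝ V] (C : Set V) : Prop :=
  ∃ (k : ℕ) (f : Fin k → (V →ₗ[ℝ] ℝ)) (d : Fin k → ℝ), C = {z | ∀ i, f i z ≤ d i}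

/-- A polyhedral convex function: its epigraph is a polyhedral convex set. -/
def IsPolyhedralFunction (p : E → EReal) : Prop := IsPolyhedralSet (epigraph p)

/-- The subdifferential `∂p(x)` in the sense of convex analysis. -/
def subdifferential (p : E → EReal) (x : E) : Set E :=
  {u | ∀ z, p x + ((inner ℝ u (z - x) : ℝ) : EReal) ≤ p z}

/-- The Fenchel conjugate `p*(u) = sup_x { ⟨u, x⟩ - p(x) }`. -/
def fenchelConjugate (p : E → EReal) (u : E) : EReal :=
  ⨆ x : E, ((inner ℝ u x : ℝ) : EReal) - p x

/-- `z` minimizes `w ↦ p(w) + ½‖w - x‖²`. -/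
def IsProxPoint (p : E → EReal) (x z : E) : Prop :=
  ∀ w, p z + ((1 / 2 * ‖z - x‖ ^ 2 : ℝ) : EReal) ≤ p w + ((1 / 2 * ‖w - x‖ ^ 2 : ℝ) : EReal)

/-- The proximal mapping `Prox_p(x) = argmin_w { p(w) + ½‖w - x‖² }`
(the minimizer exists and is unique for a proper closed convex `p` on a Euclidean space). -/
def prox (p : E → EReal) (x : E) : E := Classical.epsilon (IsProxPoint p x)

/-- The metric projection `Π_C(x)`, the point of `C` nearest to `x`
(it exists and is unique for a nonempty closed convex `C` in a Euclidean space). -/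
def metricProjection (C : Set E) (x : E) : E :=
  Classical.epsilon fun z => z ∈ C ∧ ∀ w ∈ C, ‖z - x‖ ≤ ‖w - x‖

end ConvexAnalysis

/-! ### Generalized Jacobians, strong semismoothness, piecewise affine functions -/

section Nonsmooth

variable {X Y : Type*} [NormedAddCommGroup X] [NormedSpace ℝ X]
  [NormedAddCommGroup Y] [NormedSpace ℝ Y]

/-- The B-subdifferential: all limits of `F'(xᵏ)` with `xᵏ → x`, `F` differentiable at `xᵏ`. -/
def bSubdifferential (F : X → Y) (x : X) : Set (X →L[ℝ] Y) :=
  {V | ∃ s : ℕ → X, Tendsto s atTop (𝓝 x) ∧ (∀ k, DifferentiableAt ℝ F (s k)) ∧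
    Tendsto (fun k => fderiv ℝ F (s k)) atTop (𝓝 V)}

/-- The Clarke generalized Jacobian. -/
def clarkeJacobian (F : X → Y) (x : X) : Set (X →L[ℝ] Y) :=
  convexHull ℝ (bSubdifferential F x)

/-- One-sided directional differentiability at `x`, in every direction. -/
def DirectionallyDifferentiableAt (F : X → Y) (x : X) : Prop :=
  ∀ h : X, ∃ d : Y, Tendsto (fun t : ℝ => t⁻¹ • (F (x + t • h) - F x)) (𝓝[>] 0) (𝓝 d)

/-- `F`, regarded as a function on the open set `O`, is strongly semismooth at `x ∈ O`:
it is locally Lipschitz on `O`, directionally differentiable at `x`, and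
`F(x + h) - F(x) - V h = O(‖h‖²)` for `V ∈ ∂F(x + h)`, `h → 0`. -/
structure StronglySemismoothAt (F : X → Y) (O : Set X) (x : X) : Prop where
  isOpen : IsOpen O
  mem : x ∈ O
  locallyLipschitz : LocallyLipschitzOn O F
  directionallyDifferentiable : DirectionallyDifferentiableAt F x
  estimate : ∃ C : ℝ, ∀ᶠ h in 𝓝 (0 : X), ∀ V ∈ clarkeJacobian F (x + h),
    ‖F (x + h) - F x - V h‖ ≤ C * ‖h‖ ^ 2

/-- `F` is strongly semismooth everywhere on the open set `O`. -/
def StronglySemismoothOn (F : X → Y) (O : Set X) : Prop :=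
  ∀ x ∈ O, StronglySemismoothAt F O x

/-- For `H` in two variables, `∂_x H(x, l)`: the canonical projection of the Clarke generalized
Jacobian `∂H(x, l)` onto the first variable, `{V_x | ∃ V_l, [V_x, V_l] ∈ ∂H(x, l)}`. -/
def partialClarkeJacobian {Z : Type*} [NormedAddCommGroup Z] [NormedSpace ℝ Z]
    (H : X × Z → Y) (z : X × Z) : Set (X →L[ℝ] Y) :=
  (fun V : X × Z →L[ℝ] Y => V.comp (ContinuousLinearMap.inl ℝ X Z)) '' clarkeJacobian H z

/-- A set of linear operators is nondegenerate if all its elements are nonsingular. -/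
def IsNondegenerate (S : Set (X →L[ℝ] Y)) : Prop := ∀ V ∈ S, Function.Bijective V

/-- `F` is piecewise affine on `D`: it is continuous there, and at every point of `D` it agrees
with one member of a fixed finite family of affine functions. -/
def IsPiecewiseAffineOn (F : X → Y) (D : Set X) : Prop :=
  ContinuousOn F D ∧ ∃ (k : ℕ) (G : Fin k → (X →ᵃ[ℝ] Y)), ∀ x ∈ D, ∃ i, F x = G i x

end Nonsmooth

/-! ### The regularized least-squares problem -/

section LeastSquares

variable {m n : ℕ}

/-- `Φ(x) = ½‖Ax - b‖²`. -/
def leastSquares (A : Matrix (Fin m) (Fin n) ℝ) (b : EuclideanSpace ℝ (Fin m))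
    (x : EuclideanSpace ℝ (Fin n)) : ℝ :=
  1 / 2 * ‖Matrix.toEuclideanLin A x - b‖ ^ 2

/-- The solution set `Ω(l)` of `min_x ½‖Ax - b‖² + l p(x)`. -/
def primalSolutions (p : EuclideanSpace ℝ (Fin n) → EReal) (A : Matrix (Fin m) (Fin n) ℝ)
    (b : EuclideanSpace ℝ (Fin m)) (l : ℝ) : Set (EuclideanSpace ℝ (Fin n)) :=
  {x | ∀ z, (leastSquares A b x : EReal) + (l : EReal) * p x
      ≤ (leastSquares A b z : EReal) + (l : EReal) * p z}

/-- The dual objective `-½‖y‖² + ⟨b, y⟩ - l p*(u)`. -/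
def dualObjective (p : EuclideanSpace ℝ (Fin n) → EReal) (b : EuclideanSpace ℝ (Fin m)) (l : ℝ)
    (y : EuclideanSpace ℝ (Fin m)) (u : EuclideanSpace ℝ (Fin n)) : EReal :=
  ((-(1 / 2) * ‖y‖ ^ 2 + inner ℝ b y : ℝ) : EReal) - (l : EReal) * fenchelConjugate p u

/-- `(y, u)` solves the dual problem
`max { -½‖y‖² + ⟨b, y⟩ - l p*(u) | Aᵀ y - l u = 0 }`. -/
def IsDualSolution (p : EuclideanSpace ℝ (Fin n) → EReal) (A : Matrix (Fin m) (Fin n) ℝ)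
    (b : EuclideanSpace ℝ (Fin m)) (l : ℝ)
    (y : EuclideanSpace ℝ (Fin m)) (u : EuclideanSpace ℝ (Fin n)) : Prop :=
  Matrix.toEuclideanLin A.transpose y - l • u = 0 ∧
    ∀ (y' : EuclideanSpace ℝ (Fin m)) (u' : EuclideanSpace ℝ (Fin n)),
      Matrix.toEuclideanLin A.transpose y' - l • u' = 0 →
        dualObjective p b l y' u' ≤ dualObjective p b l y u

/-- The proximal residual `H(x, l) = x - Prox_p(x - l⁻¹ ∇Φ(x))`. -/
def proxResidual (p : EuclideanSpace ℝ (Fin n) → EReal) (A : Matrix (Fin m) (Fin n) ℝ)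
    (b : EuclideanSpace ℝ (Fin m)) (z : EuclideanSpace ℝ (Fin n) × ℝ) :
    EuclideanSpace ℝ (Fin n) :=
  z.1 - prox p (z.1 - z.2⁻¹ • gradient (leastSquares A b) z.1)

end LeastSquares

end

/-! A closed gauge is the support function of C = ∂p(0), so p* is the indicator of C and Prox_p = id
- Π_C (`IsGaugeFunction.prox_eq`). Primal optimality becomes the condition `IsKKTPoint`: λ⁻¹Aᵀ(b -
Ax) lies in C and maximizes ⟨·, x⟩ over C. This is the equation H(x, λ) = 0
(`projectionResidual_eq_zero_iff`). The dual solution is y = b - Ax, and y/λ is the projection of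
b/λ onto {v | Aᵀv ∈ C}; hence y is locally Lipschitz.

Strong semismoothness in one variable is reduced to `HasLipschitzSlopeAt`: the quotient q(t) =
(f(λ+t) - f(λ))/t is Lipschitz on each side of 0. Then q has one-sided limits, and the bound on q'
is the second-order estimate multiplied by t⁻². The property survives affine maps and norms, so it
passes from x to y and from y to φ = ‖y‖.

For (i), the property is proved for x itself (`hasLipschitzSlopeAt_path`). Let z_t = (x(λ̄+t),
λ̄+t); H vanishes along z. For V in the limiting Jacobian at z_t, the semismooth estimate of H gives
V(z_t - z_0) = O(t²), and V(z_t - z_s) = O(|t-s|²) with a constant depending on s. The combination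
t(z_t - z_s) - (t-s)(z_t - z_0) has no λ-component, and its x-component s(x_t - x_0) - t(x_s - x_0)
is ts times the variation of q. Nondegeneracy bounds V(·, 0) from below, which controls that
variation. Any selection of solutions passes through x̄ and is calm there: the same estimate
isolates x̄, and convexity keeps nearby solutions from escaping.

For (ii), the problem is a quadratic program over the polyhedral epigraph. Among parameters with the
same active constraints the residual is affine in λ, and there are finitely many active sets. A
piecewise affine function has locally constant one-sided quotients. -/

open Set Filter Topology

noncomputable section

/-! ### Closed gauges as support functions; their conjugates. -/

section GaugeFunctions

variable {E : Type*} [NormedAddCommGroup E] [InnerProductSpace ℝ E] {p : E → EReal}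

namespace IsGaugeFunction

lemma ne_bot (hp : IsGaugeFunction p) (z : E) : p z ≠ ⊥ := fun h => by
  have := hp.nonneg z
  rw [h] at this
  exact absurd this (by simp)

lemma zero_mem_epigraph (hp : IsGaugeFunction p) : ((0, 0) : E × ℝ) ∈ epigraph p := by
  simp [epigraph, hp.map_zero]

lemma snd_nonneg (hp : IsGaugeFunction p) {z : E × ℝ} (hz : z ∈ epigraph p) : 0 ≤ z.2 := by
  have : (0 : EReal) ≤ (z.2 : EReal) := (hp.nonneg z.1).trans hz
  exact_mod_cast this

lemma smul_mem (hp : IsGaugeFunction p) {z : E × ℝ} (hz : z ∈ epigraph p) {k : ℝ} (hk : 0 < k) :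
    k • z ∈ epigraph p := by
  have hz' : p z.1 ≤ (z.2 : EReal) := hz
  change p (k • z.1) ≤ ((k * z.2 : ℝ) : EReal)
  rw [hp.pos_homogeneous k z.1 hk, EReal.coe_mul]
  exact mul_le_mul_of_nonneg_left hz' (by exact_mod_cast hk.le)

lemma add_mem (hp : IsGaugeFunction p) {z w : E × ℝ} (hz : z ∈ epigraph p)
    (hw : w ∈ epigraph p) : z + w ∈ epigraph p := by
  have h := hp.convex (hp.smul_mem hz two_pos) (hp.smul_mem hw two_pos)
    (a := 1 / 2) (b := 1 / 2) (by norm_num) (by norm_num) (by norm_num)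
  simpa [smul_smul] using h

/-- Replaces extended-real inequalities by real ones indexed by the epigraph, exhibiting ∂p(0) as an
intersection of half-spaces. -/
lemma mem_subdifferential_zero_iff (hp : IsGaugeFunction p) {c : E} :
    c ∈ subdifferential p 0 ↔ ∀ z ∈ epigraph p, inner ℝ c z.1 ≤ z.2 := by
  simp only [subdifferential, hp.map_zero, zero_add, sub_zero, mem_ofPred_eq]
  constructor
  · intro h z hz
    exact_mod_cast (h z.1).trans hz
  · intro h z
    induction hq : p z with
    | bot => exact absurd hq (hp.ne_bot z)
    | top => exact le_top
    | coe r => exact_mod_cast h (z, r) hq.le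

lemma zero_mem_subdifferential (hp : IsGaugeFunction p) : (0 : E) ∈ subdifferential p 0 :=
  hp.mem_subdifferential_zero_iff.2 fun z hz => by simpa using hp.snd_nonneg hz

lemma isClosed_subdifferential (hp : IsGaugeFunction p) : IsClosed (subdifferential p 0) := by
  have : subdifferential p 0 = ⋂ z ∈ epigraph p, {c : E | inner ℝ c z.1 ≤ z.2} := by
    ext c
    simp only [hp.mem_subdifferential_zero_iff, mem_iInter, mem_ofPred_eq]
  rw [this]
  exact isClosed_biInter fun z _ =>
    isClosed_le (Continuous.inner continuous_id continuous_const) continuous_const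

lemma convex_subdifferential (hp : IsGaugeFunction p) : Convex ℝ (subdifferential p 0) := by
  intro c hc d hd s t hs ht hst
  rw [hp.mem_subdifferential_zero_iff] at hc hd ⊢
  intro z hz
  rw [inner_add_left, real_inner_smul_left, real_inner_smul_left]
  calc s * inner ℝ c z.1 + t * inner ℝ d z.1 ≤ s * z.2 + t * z.2 :=
        add_le_add (mul_le_mul_of_nonneg_left (hc z hz) hs)
          (mul_le_mul_of_nonneg_left (hd z hz) ht)
    _ = z.2 := by rw [← add_mul, hst, one_mul]

/-- A closed gauge function is the support function of its subdifferential at the origin. -/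
lemma mem_epigraph_of_inner_le [CompleteSpace E] (hp : IsGaugeFunction p)
    (hc : LowerSemicontinuous p) {z : E} {t : ℝ}
    (h : ∀ c ∈ subdifferential p 0, inner ℝ c z ≤ t) : (z, t) ∈ epigraph p := by
  by_contra hzt
  have hclosed : IsClosed (epigraph p) :=
    hc.isClosed_epigraph.preimage
      (continuous_fst.prodMk (continuous_coe_real_ereal.comp continuous_snd) :
        Continuous fun z : E × ℝ => (z.1, (z.2 : EReal)))
  obtain ⟨f, r, hf, hr⟩ := geometric_hahn_banach_closed_point hp.convex hclosed hzt
  have hr0 : 0 < r := by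
    have := hf _ hp.zero_mem_epigraph
    rwa [Prod.mk_zero_zero, _root_.map_zero] at this
  -- The epigraph is a cone, so a functional bounded above on it is nonpositive on it.
  have hf0 : ∀ a ∈ epigraph p, f a ≤ 0 := by
    intro a ha
    by_contra! hpos
    have := hf _ (hp.smul_mem ha (div_pos hr0 hpos))
    rw [map_smul, smul_eq_mul, div_mul_cancel₀ _ hpos.ne'] at this
    exact lt_irrefl _ this
  set v := (InnerProductSpace.toDual ℝ E).symm (f.comp (ContinuousLinearMap.inl ℝ E ℝ)) with hv
  set α := f (0, 1) with hα
  have hfv : ∀ (a : E) (s : ℝ), f (a, s) = inner ℝ v a + s * α := by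
    intro a s
    rw [hv, InnerProductSpace.toDual_symm_apply, hα, ← smul_eq_mul, ← map_smul]
    simp [← map_add]
  have hα0 : α ≤ 0 := hf0 _ (by simp [epigraph, hp.map_zero])
  have hzpos : 0 < inner ℝ v z + t * α := by rw [← hfv]; exact hr0.trans hr
  -- A non-vertical hyperplane, once normalized, is a subgradient violating `h`. For a vertical one
  -- every nonnegative multiple of `v` is a subgradient, and the multiple below has inner product
  -- |t| + 1 with `z`.
  rcases hα0.lt_or_eq with hneg | hzero
  · have hmem : (-α)⁻¹ • v ∈ subdifferential p 0 := by
      rw [hp.mem_subdifferential_zero_iff]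
      intro a ha
      have := hf0 a ha
      rw [show a = (a.1, a.2) from rfl, hfv] at this
      rw [real_inner_smul_left, inv_mul_le_iff₀ (by linarith)]
      linarith
    have := h _ hmem
    rw [real_inner_smul_left, inv_mul_le_iff₀ (by linarith)] at this
    linarith
  · rw [hzero, mul_zero, add_zero] at hzpos
    have hmem : ((|t| + 1) / inner ℝ v z) • v ∈ subdifferential p 0 := by
      rw [hp.mem_subdifferential_zero_iff]
      intro a ha
      have h1 := hf0 a ha
      rw [show a = (a.1, a.2) from rfl, hfv, hzero, mul_zero, add_zero] at h1
      rw [real_inner_smul_left]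
      exact (mul_nonpos_of_nonneg_of_nonpos (by positivity) h1).trans (hp.snd_nonneg ha)
    have := h _ hmem
    rw [real_inner_smul_left, div_mul_cancel₀ _ hzpos.ne'] at this
    linarith [le_abs_self t]

lemma fenchelConjugate_eq_zero (hp : IsGaugeFunction p) {c : E}
    (hc : c ∈ subdifferential p 0) : fenchelConjugate p c = 0 := by
  refine le_antisymm (iSup_le fun x => ?_) ?_
  · induction hq : p x with
    | bot => exact absurd hq (hp.ne_bot x)
    | top => simp
    | coe r =>
      have := hp.mem_subdifferential_zero_iff.1 hc (x, r) hq.le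
      rw [← EReal.coe_sub]
      exact_mod_cast sub_nonpos.2 this
  · refine le_trans ?_ (le_iSup (fun x : E => ((inner ℝ c x : ℝ) : EReal) - p x) 0)
    simp [hp.map_zero]

/-- An epigraph point violating the subgradient inequality can be scaled, and the violation grows
without bound along its ray. -/
lemma fenchelConjugate_eq_top (hp : IsGaugeFunction p) {c : E}
    (hc : c ∉ subdifferential p 0) : fenchelConjugate p c = ⊤ := by
  rw [hp.mem_subdifferential_zero_iff] at hc
  push Not at hc
  obtain ⟨z, hz, hlt⟩ := hc
  rw [EReal.eq_top_iff_forall_lt]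
  intro M
  have hd : 0 < inner ℝ c z.1 - z.2 := sub_pos.2 hlt
  set k := (|M| + 1) / (inner ℝ c z.1 - z.2) with hk
  have hk0 : 0 < k := by positivity
  have hkz : p (k • z.1) ≤ ((k * z.2 : ℝ) : EReal) := hp.smul_mem hz hk0
  calc (M : EReal) < ((inner ℝ c (k • z.1) - k * z.2 : ℝ) : EReal) := by
        rw [real_inner_smul_right, ← mul_sub, hk, div_mul_cancel₀ _ hd.ne']
        exact_mod_cast (le_abs_self M).trans_lt (lt_add_one _)
    _ ≤ ((inner ℝ c (k • z.1) : ℝ) : EReal) - p (k • z.1) := by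
        rw [EReal.coe_sub]
        exact EReal.sub_le_sub le_rfl hkz
    _ ≤ _ := le_iSup (fun x : E => ((inner ℝ c x : ℝ) : EReal) - p x) (k • z.1)

end IsGaugeFunction

end GaugeFunctions

/-! ### Metric projections and Moreau's decomposition. -/

section Projection

variable {E : Type*} [NormedAddCommGroup E] [InnerProductSpace ℝ E] {C : Set E}

lemma norm_sub_sq_le_of_inner_le {w v c : E} (h : inner ℝ (w - v) (c - v) ≤ 0) :
    ‖v - w‖ ^ 2 + ‖c - v‖ ^ 2 ≤ ‖c - w‖ ^ 2 := by
  have : c - w = (c - v) + (v - w) := by abel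
  rw [this, norm_add_sq_real]
  have h2 : inner ℝ (c - v) (v - w) = - inner ℝ (w - v) (c - v) := by
    rw [real_inner_comm, ← inner_neg_left, neg_sub]
  rw [h2]
  linarith

/-- The obtuse-angle inequality makes `v` the unique nearest point, so the choice made in
`metricProjection` must return it. -/
lemma metricProjection_eq {w v : E} (hv : v ∈ C)
    (h : ∀ c ∈ C, inner ℝ (w - v) (c - v) ≤ 0) : metricProjection C w = v := by
  have hex : ∃ z, z ∈ C ∧ ∀ c ∈ C, ‖z - w‖ ≤ ‖c - w‖ := by
    refine ⟨v, hv, fun c hc => ?_⟩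
    have := norm_sub_sq_le_of_inner_le (h c hc)
    exact abs_le_of_sq_le_sq' (by nlinarith [sq_nonneg ‖c - v‖]) (norm_nonneg _) |>.2
  obtain ⟨h1, h2⟩ := Classical.epsilon_spec hex
  change metricProjection C w ∈ C at h1
  change ∀ c ∈ C, ‖metricProjection C w - w‖ ≤ ‖c - w‖ at h2
  have h3 := norm_sub_sq_le_of_inner_le (h _ h1)
  have h4 := h2 v hv
  have h5 : ‖metricProjection C w - v‖ ^ 2 ≤ 0 := by
    nlinarith [norm_nonneg (metricProjection C w - w)]
  exact sub_eq_zero.1 (norm_eq_zero.1 (pow_eq_zero_iff two_ne_zero |>.1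
    (le_antisymm h5 (sq_nonneg _))))

lemma metricProjection_spec [CompleteSpace E] (hne : C.Nonempty) (hcl : IsClosed C)
    (hconv : Convex ℝ C) (w : E) : metricProjection C w ∈ C ∧
      ∀ c ∈ C, inner ℝ (w - metricProjection C w) (c - metricProjection C w) ≤ 0 := by
  obtain ⟨v, hv, hv'⟩ := exists_norm_eq_iInf_of_complete_convex hne hcl.isComplete hconv w
  have h := (norm_eq_iInf_iff_real_inner_le_zero hconv hv).1 hv'
  rw [metricProjection_eq hv h]
  exact ⟨hv, h⟩

/-- Adding the two variational inequalities gives firm nonexpansiveness. Only these inequalities are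
assumed, so it also applies to the dual feasible set, for which no projection is constructed. -/
lemma norm_sub_le_of_inner_le {w₁ w₂ v₁ v₂ : E} (h₁ : inner ℝ (w₁ - v₁) (v₂ - v₁) ≤ 0)
    (h₂ : inner ℝ (w₂ - v₂) (v₁ - v₂) ≤ 0) : ‖v₁ - v₂‖ ≤ ‖w₁ - w₂‖ := by
  have hle : ‖v₁ - v₂‖ ^ 2 ≤ inner ℝ (w₁ - w₂) (v₁ - v₂) := by
    rw [← real_inner_self_eq_norm_sq]
    have e : inner ℝ (w₁ - v₁) (v₂ - v₁) + inner ℝ (w₂ - v₂) (v₁ - v₂)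
        = inner ℝ (v₁ - v₂) (v₁ - v₂) - inner ℝ (w₁ - w₂) (v₁ - v₂) := by
      rw [← neg_sub v₁ v₂, inner_neg_right]
      simp only [inner_sub_left]
      ring
    linarith
  have := hle.trans (real_inner_le_norm _ _)
  by_contra! hlt
  nlinarith [norm_nonneg (w₁ - w₂), norm_nonneg (v₁ - v₂)]

lemma lipschitzWith_metricProjection [CompleteSpace E] (hne : C.Nonempty) (hcl : IsClosed C)
    (hconv : Convex ℝ C) : LipschitzWith 1 (metricProjection C) := by
  refine LipschitzWith.of_dist_le_mul fun w₁ w₂ => ?_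
  obtain ⟨h₁, h₁'⟩ := metricProjection_spec hne hcl hconv w₁
  obtain ⟨h₂, h₂'⟩ := metricProjection_spec hne hcl hconv w₂
  simpa [dist_eq_norm] using norm_sub_le_of_inner_le (h₁' _ h₂) (h₂' _ h₁)

/-- Moreau's decomposition for a closed gauge function. -/
lemma IsGaugeFunction.prox_eq [CompleteSpace E] {p : E → EReal} (hp : IsGaugeFunction p)
    (hc : LowerSemicontinuous p) (w : E) :
    prox p w = w - metricProjection (subdifferential p 0) w := by
  obtain ⟨hv, hv'⟩ := metricProjection_spec ⟨0, hp.zero_mem_subdifferential⟩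
    hp.isClosed_subdifferential hp.convex_subdifferential w
  set v := metricProjection (subdifferential p 0) w
  set z := w - v with hz
  have hpz : (z, inner ℝ v z) ∈ epigraph p := by
    refine hp.mem_epigraph_of_inner_le hc fun c hc => ?_
    have := hv' c hc
    rw [real_inner_comm, inner_sub_left] at this
    linarith
  -- Quadratic growth around `z`, from the subgradient `v = w - z`. It yields minimality of `z` and
  -- then uniqueness of the minimizer.
  have key : ∀ a t, (a, t) ∈ epigraph p →
      inner ℝ v z + 1 / 2 * ‖z - w‖ ^ 2 + 1 / 2 * ‖a - z‖ ^ 2 ≤ t + 1 / 2 * ‖a - w‖ ^ 2 := by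
    intro a t ha
    have h1 := hp.mem_subdifferential_zero_iff.1 hv _ ha
    have h2 : a - w = (a - z) + (z - w) := by abel
    have h3 : z - w = -v := by rw [hz]; abel
    rw [h2, norm_add_sq_real, h3, inner_neg_right, real_inner_comm v (a - z), inner_sub_right v a z]
    simp only at h1
    linarith
  have hprox : IsProxPoint p w z := by
    intro a
    induction hq : p a with
    | bot => exact absurd hq (hp.ne_bot a)
    | top => exact le_of_le_of_eq le_top (EReal.top_add_coe _).symm
    | coe r =>
      have h1 : p z ≤ ((inner ℝ v z : ℝ) : EReal) := hpz
      refine (add_le_add_left h1 _).trans ?_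
      have := key a r hq.le
      exact_mod_cast (by nlinarith [sq_nonneg ‖a - z‖] :
        inner ℝ v z + 1 / 2 * ‖z - w‖ ^ 2 ≤ r + 1 / 2 * ‖a - w‖ ^ 2)
  have h1 : IsProxPoint p w (prox p w) := Classical.epsilon_spec ⟨z, hprox⟩
  have h2 := h1 z
  have h3 : p (prox p w) + ((1 / 2 * ‖prox p w - w‖ ^ 2 : ℝ) : EReal)
      ≤ ((inner ℝ v z + 1 / 2 * ‖z - w‖ ^ 2 : ℝ) : EReal) := by
    refine h2.trans ?_
    rw [EReal.coe_add]
    exact add_le_add_left (show p z ≤ _ from hpz) _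
  induction hq : p (prox p w) with
  | bot => exact absurd hq (hp.ne_bot _)
  | top =>
    rw [hq, EReal.top_add_coe] at h3
    exact absurd h3 (not_le.2 (EReal.coe_lt_top _))
  | coe r =>
    rw [hq] at h3
    have h4 : r + 1 / 2 * ‖prox p w - w‖ ^ 2 ≤ inner ℝ v z + 1 / 2 * ‖z - w‖ ^ 2 := by
      exact_mod_cast h3
    have h5 := key (prox p w) r hq.le
    have h6 : ‖prox p w - z‖ ^ 2 ≤ 0 := by linarith
    exact sub_eq_zero.1 (norm_eq_zero.1 (pow_eq_zero_iff two_ne_zero |>.1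
      (le_antisymm h6 (sq_nonneg _))))

end Projection

/-! ### Strong semismoothness in one variable via difference quotients. -/

section OneVariable

variable {F : Type*} [NormedAddCommGroup F] [NormedSpace ℝ F]

/-- A function of one real variable whose difference quotient at `l` is Lipschitz on each side
of `l`. -/
def HasLipschitzSlopeAt (f : ℝ → F) (l : ℝ) : Prop :=
  ∃ (K : NNReal) (δ : ℝ), 0 < δ ∧
    LipschitzOnWith K (fun t : ℝ => t⁻¹ • (f (l + t) - f l)) (Ioo 0 δ) ∧
    LipschitzOnWith K (fun t : ℝ => t⁻¹ • (f (l + t) - f l)) (Ioo (-δ) 0)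

/-- A Lipschitz function on a one-sided interval has a limit at its endpoint. -/
lemma LipschitzOnWith.exists_tendsto {F : Type*} [NormedAddCommGroup F] {K : NNReal} {q : ℝ → F} {s : Set ℝ} {a : ℝ}
    [CompleteSpace F] (h : LipschitzOnWith K q s) [(𝓝[s] a).NeBot] :
    ∃ d, Tendsto q (𝓝[s] a) (𝓝 d) := by
  refine CompleteSpace.complete (Cauchy.map_of_le (cauchy_nhds.mono nhdsWithin_le_nhds)
    h.uniformContinuousOn ?_)
  exact inf_le_right

lemma HasLipschitzSlopeAt.directionallyDifferentiableAt [CompleteSpace F] {f : ℝ → F} {l : ℝ}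
    (hf : HasLipschitzSlopeAt f l) : DirectionallyDifferentiableAt f l := by
  obtain ⟨K, δ, hδ, h₁, h₂⟩ := hf
  have : (𝓝[Ioo (0 : ℝ) δ] 0).NeBot := left_nhdsWithin_Ioo_neBot hδ
  have : (𝓝[Ioo (-δ) (0 : ℝ)] 0).NeBot := right_nhdsWithin_Ioo_neBot (by linarith)
  obtain ⟨d₁, hd₁⟩ := h₁.exists_tendsto (a := 0)
  obtain ⟨d₂, hd₂⟩ := h₂.exists_tendsto (a := 0)
  rw [nhdsWithin_Ioo_eq_nhdsGT hδ] at hd₁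
  rw [nhdsWithin_Ioo_eq_nhdsLT (by linarith)] at hd₂
  have aux : ∀ (h : ℝ) (d : F), h ≠ 0 →
      Tendsto (fun t : ℝ => (t * h)⁻¹ • (f (l + t * h) - f l)) (𝓝[>] 0) (𝓝 d) →
      Tendsto (fun t : ℝ => t⁻¹ • (f (l + t • h) - f l)) (𝓝[>] 0) (𝓝 (h • d)) := by
    intro h d hh H
    refine (H.const_smul h).congr fun t => ?_
    rw [smul_smul, mul_inv, mul_comm t⁻¹, ← mul_assoc, mul_inv_cancel₀ hh, one_mul, smul_eq_mul]
  have hc : ∀ h : ℝ, Tendsto (fun t : ℝ => t * h) (𝓝[>] 0) (𝓝 0) := fun h => by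
    have : Tendsto (fun t : ℝ => t * h) (𝓝 0) (𝓝 (0 * h)) :=
      (continuous_id.mul continuous_const).tendsto 0
    rw [zero_mul] at this
    exact this.mono_left nhdsWithin_le_nhds
  intro h
  rcases lt_trichotomy h 0 with hh | rfl | hh
  · refine ⟨h • d₂, aux h d₂ hh.ne (hd₂.comp (tendsto_nhdsWithin_iff.2 ⟨hc h, ?_⟩))⟩
    filter_upwards [self_mem_nhdsWithin] with t ht using mul_neg_of_pos_of_neg ht hh
  · exact ⟨0, by simp⟩
  · refine ⟨h • d₁, aux h d₁ hh.ne' (hd₁.comp (tendsto_nhdsWithin_iff.2 ⟨hc h, ?_⟩))⟩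
    filter_upwards [self_mem_nhdsWithin] with t ht using mul_pos ht hh

/-- The left-hand side is t² times the norm of the derivative of the quotient at t, and that
derivative is bounded by the Lipschitz constant. -/
lemma norm_sub_sub_smul_le_of_lipschitzOnWith {f : ℝ → F} {l : ℝ} {K : NNReal} {s : Set ℝ}
    (hs : IsOpen s) (h0 : (0 : ℝ) ∉ s)
    (h : LipschitzOnWith K (fun t : ℝ => t⁻¹ • (f (l + t) - f l)) s) {t : ℝ} (ht : t ∈ s)
    {V : ℝ →L[ℝ] F} (hV : HasFDerivAt f V (l + t)) :
    ‖f (l + t) - f l - V t‖ ≤ K * ‖t‖ ^ 2 := by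
  have ht0 : t ≠ 0 := fun h => h0 (h ▸ ht)
  have hd1 : HasDerivAt (fun τ : ℝ => f (l + τ) - f l) (V 1) t := by
    have := hV.hasDerivAt.comp_const_add l t
    exact this.sub_const _
  have hd2 := (hasDerivAt_inv ht0).smul hd1
  have hb := hd2.hasFDerivAt.le_of_lip' (C := K) K.2 (by
    filter_upwards [hs.mem_nhds ht] with τ hτ
    simpa [dist_eq_norm] using h.dist_le_mul τ hτ t ht)
  rw [ContinuousLinearMap.norm_toSpanSingleton] at hb
  have e : f (l + t) - f l - V t
      = -(t ^ 2) • (t⁻¹ • V 1 + -(t ^ 2)⁻¹ • (f (l + t) - f l)) := by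
    have : V t = t • V 1 := by rw [← map_smul, smul_eq_mul, mul_one]
    rw [this, smul_add, smul_smul, smul_smul,
      show -t ^ 2 * t⁻¹ = -t by field_simp, show -t ^ 2 * -(t ^ 2)⁻¹ = 1 by field_simp]
    module
  rw [e, norm_smul, norm_neg, norm_pow, mul_comm]
  exact mul_le_mul_of_nonneg_right hb (by positivity)

/-- The second-order estimate passes from derivatives to the Clarke generalized Jacobian. -/
lemma estimate_clarkeJacobian_of_differentiableAt {X Y : Type*} [NormedAddCommGroup X]
    [NormedSpace ℝ X] [NormedAddCommGroup Y] [NormedSpace ℝ Y] {f : X → Y} {x : X} {C : ℝ}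
    {O : Set X} (hO : IsOpen O) (hf : ContinuousOn f O)
    (h : ∀ z ∈ O, DifferentiableAt ℝ f z →
      ‖f z - f x - fderiv ℝ f z (z - x)‖ ≤ C * ‖z - x‖ ^ 2)
    {z : X} (hz : z ∈ O) {V : X →L[ℝ] Y} (hV : V ∈ clarkeJacobian f z) :
    ‖f z - f x - V (z - x)‖ ≤ C * ‖z - x‖ ^ 2 := by
  have hconv : Convex ℝ {V : X →L[ℝ] Y | ‖f z - f x - V (z - x)‖ ≤ C * ‖z - x‖ ^ 2} := by
    intro V hV W hW s t hs ht hst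
    have := convex_closedBall (0 : Y) (C * ‖z - x‖ ^ 2) (mem_closedBall_zero_iff.2 hV)
      (mem_closedBall_zero_iff.2 hW) hs ht hst
    rw [mem_closedBall_zero_iff] at this
    have e : f z - f x - (s • V + t • W) (z - x)
        = s • (f z - f x - V (z - x)) + t • (f z - f x - W (z - x)) := by
      simp only [add_apply, smul_apply]
      rw [show t = 1 - s by linarith]
      module
    change ‖_‖ ≤ _
    rwa [e]
  -- The condition on V is convex, so only limits of derivatives remain; the inequality is closed
  -- under these limits.
  refine convexHull_min ?_ hconv hV
  rintro V ⟨s, hs, hd, hlim⟩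
  have hfs : Tendsto (fun k => f (s k)) atTop (𝓝 (f z)) :=
    (hf.continuousAt (hO.mem_nhds hz)).tendsto.comp hs
  have hsub : Tendsto (fun k => s k - x) atTop (𝓝 (z - x)) := hs.sub_const x
  have hVs : Tendsto (fun k => fderiv ℝ f (s k) (s k - x)) atTop (𝓝 (V (z - x))) :=
    (isBoundedBilinearMap_apply.continuous.tendsto (V, z - x)).comp (hlim.prodMk_nhds hsub)
  refine le_of_tendsto_of_tendsto ((hfs.sub_const _).sub (hVs)).norm
    ((hsub.norm.pow 2).const_mul C) ?_
  filter_upwards [hs.eventually (hO.mem_nhds hz)] with k hk using h _ hk (hd k)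

/-- Strong semismoothness in one variable from one-sided Lipschitz difference quotients. -/
lemma HasLipschitzSlopeAt.stronglySemismoothAt [CompleteSpace F] {f : ℝ → F} {l : ℝ} {O : Set ℝ}
    (hO : IsOpen O) (hl : l ∈ O) (hf : LocallyLipschitzOn O f) (h : HasLipschitzSlopeAt f l) :
    StronglySemismoothAt f O l where
  isOpen := hO
  mem := hl
  locallyLipschitz := hf
  directionallyDifferentiable := h.directionallyDifferentiableAt
  estimate := by
    obtain ⟨K, δ, hδ, h₁, h₂⟩ := h
    refine ⟨K, ?_⟩
    have hmem : Tendsto (fun t : ℝ => l + t) (𝓝 0) (𝓝 l) := by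
      have : Continuous fun t : ℝ => l + t := by fun_prop
      simpa using this.tendsto 0
    filter_upwards [hmem.eventually (hO.mem_nhds hl),
      Ioo_mem_nhds (neg_lt_zero.2 hδ) hδ] with t htO ht V hV
    rcases eq_or_ne t 0 with rfl | ht0
    · simp
    -- The base point is removed: the quotient is controlled only off `l`, and sequences converging
    -- to `l + t` with t ≠ 0 eventually avoid `l`.
    have hU : IsOpen (O ∩ {z | z - l ∈ Ioo (-δ) δ ∧ z ≠ l}) :=
      hO.inter ((isOpen_Ioo.preimage (continuous_id.sub continuous_const)).inter isOpen_ne)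
    have := estimate_clarkeJacobian_of_differentiableAt (x := l) (C := K) hU
      (hf.continuousOn.mono inter_subset_left) ?_ (z := l + t) ⟨htO, by simpa using ht, by simpa⟩ hV
    · simpa using this
    rintro z ⟨-, hz, hzl⟩ hd
    obtain ⟨τ, rfl⟩ : ∃ τ, z = l + τ := ⟨z - l, by ring⟩
    simp only [add_sub_cancel_left] at hz ⊢
    have hτ : τ ≠ 0 := by simpa using hzl
    rcases hτ.lt_or_gt with hneg | hpos
    · exact norm_sub_sub_smul_le_of_lipschitzOnWith isOpen_Ioo (by simp) h₂ ⟨hz.1, hneg⟩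
        hd.hasFDerivAt
    · exact norm_sub_sub_smul_le_of_lipschitzOnWith isOpen_Ioo (by simp) h₁ ⟨hpos, hz.2⟩
        hd.hasFDerivAt

lemma LocallyLipschitzOn.norm {F : Type*} [NormedAddCommGroup F] {f : ℝ → F} {O : Set ℝ} (hf : LocallyLipschitzOn O f) :
    LocallyLipschitzOn O fun t => ‖f t‖ := by
  intro x hx
  obtain ⟨K, t, ht, h⟩ := hf hx
  refine ⟨K, t, ht, ?_⟩
  have := lipschitzWith_one_norm.comp_lipschitzOnWith h
  rwa [one_mul] at this

/-- A pointwise Lipschitz bound with a uniform constant on an interval is a Lipschitz bound. -/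
lemma lipschitzOnWith_Ioo_of_eventually {F : Type*} [NormedAddCommGroup F] {q : ℝ → F} {a b : ℝ} {C : NNReal}
    (h : ∀ s ∈ Ioo a b, ∀ᶠ t in 𝓝 s, ‖q t - q s‖ ≤ C * |t - s|) :
    LipschitzOnWith C q (Ioo a b) := by
  have hcont : ContinuousOn q (Ioo a b) := fun s hs => by
    refine ContinuousAt.continuousWithinAt ?_
    rw [ContinuousAt, tendsto_iff_norm_sub_tendsto_zero]
    have hlim : Tendsto (fun t : ℝ => (C : ℝ) * |t - s|) (𝓝 s) (𝓝 0) := by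
      have : Continuous fun t : ℝ => (C : ℝ) * |t - s| := by fun_prop
      simpa using this.tendsto s
    exact squeeze_zero' (Eventually.of_forall fun _ => norm_nonneg _) (h s hs) hlim
  have key : ∀ s ∈ Ioo a b, ∀ t ∈ Ioo a b, s ≤ t → ‖q t - q s‖ ≤ C * (t - s) := by
    intro s hs t ht hst
    have hsub : Icc s t ⊆ Ioo a b := fun r hr => ⟨hs.1.trans_le hr.1, hr.2.trans_lt ht.2⟩
    refine le_of_forall_pos_le_add fun ε hε => ?_
    -- The slack η makes the boundary slope strictly larger than `C`, as the comparison principle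
    -- needs, at a total cost of at most ε.
    set η := ε / (t - s + 1) with hη
    have hts : 0 < t - s + 1 := by linarith
    have hη0 : 0 < η := div_pos hε hts
    have := image_norm_le_of_liminf_right_slope_norm_lt_deriv_boundary
      (f := fun r => q r - q s) (f' := fun _ => (C : ℝ)) (a := s) (b := t)
      ((hcont.mono hsub).sub continuousOn_const) ?_
      (B := fun r => (C + η) * (r - s)) (B' := fun _ => C + η) (by simp) (by fun_prop) ?_ ?_
      (right_mem_Icc.2 hst)
    · have h2 : η * (t - s) ≤ ε := by
        rw [hη, div_mul_eq_mul_div, div_le_iff₀ hts]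
        nlinarith
      linarith
    · intro r hr c hc
      refine Eventually.frequently ?_
      filter_upwards [self_mem_nhdsWithin,
        nhdsWithin_le_nhds (h r (hsub ⟨hr.1, hr.2.le⟩))] with z hz hzr
      have hz' : 0 < z - r := sub_pos.2 hz
      rw [slope_def_field, div_lt_iff₀ hz']
      simp only [Function.comp]
      have h1 : ‖q z - q s‖ - ‖q r - q s‖ ≤ ‖q z - q r‖ := by
        simpa using norm_sub_norm_le (q z - q s) (q r - q s)
      rw [abs_of_pos hz'] at hzr
      have : (C : ℝ) * (z - r) < c * (z - r) := mul_lt_mul_of_pos_right hc hz'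
      linarith
    · intro r _
      have := ((hasDerivAt_id r).sub_const s).const_mul (C + η)
      simpa using this.hasDerivWithinAt
    · intro r _ _
      linarith
  refine LipschitzOnWith.of_dist_le_mul fun s hs t ht => ?_
  rcases le_total s t with hst | hst
  · rw [dist_comm, dist_comm s, dist_eq_norm, Real.dist_eq, abs_of_nonneg (sub_nonneg.2 hst)]
    exact key s hs t ht hst
  · rw [dist_eq_norm, Real.dist_eq, abs_of_nonneg (sub_nonneg.2 hst)]
    exact key t ht s hs hst

end OneVariable

/-! ### Lipschitz difference quotients of a norm. -/

section LipschitzSlopes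

variable {F : Type*} [NormedAddCommGroup F]

lemma LipschitzOnWith.exists_norm_le {q : ℝ → F} {K : NNReal} {s : Set ℝ} {δ : ℝ}
    (hs : ∀ t ∈ s, |t| ≤ δ) (h : LipschitzOnWith K q s) : ∃ M : ℝ, 0 ≤ M ∧ ∀ t ∈ s, ‖q t‖ ≤ M := by
  rcases s.eq_empty_or_nonempty with rfl | ⟨s₀, hs₀⟩
  · exact ⟨0, le_rfl, by simp⟩
  have hδ : 0 ≤ δ := (abs_nonneg _).trans (hs s₀ hs₀)
  refine ⟨‖q s₀‖ + K * (δ + δ), by positivity, fun t ht => ?_⟩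
  have h1 := h.dist_le_mul t ht s₀ hs₀
  rw [dist_eq_norm, Real.dist_eq] at h1
  have h2 : |t - s₀| ≤ δ + δ := (abs_sub _ _).trans (add_le_add (hs t ht) (hs s₀ hs₀))
  have h3 := mul_le_mul_of_nonneg_left h2 K.2
  have h4 := norm_le_norm_add_norm_sub' (q t) (q s₀)
  simp only [NNReal.val_eq_coe] at h3
  linarith

variable [InnerProductSpace ℝ F]

/-- Taking norms preserves Lipschitz difference quotients. -/
lemma LipschitzOnWith.norm_slope {f : ℝ → F} {l δ : ℝ} {K : NNReal} {s : Set ℝ}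
    (hs : ∀ t ∈ s, |t| ≤ δ) (hsign : (∀ t ∈ s, 0 < t) ∨ (∀ t ∈ s, t < 0))
    (h : LipschitzOnWith K (fun t : ℝ => t⁻¹ • (f (l + t) - f l)) s) :
    ∃ K' : NNReal, LipschitzOnWith K' (fun t : ℝ => t⁻¹ • (‖f (l + t)‖ - ‖f l‖)) s := by
  set q := fun t : ℝ => t⁻¹ • (f (l + t) - f l) with hq
  have hs0 : ∀ t ∈ s, t ≠ 0 := fun t ht => by
    rcases hsign with H | H
    · exact (H t ht).ne'
    · exact (H t ht).ne
  have hfq : ∀ t ∈ s, f (l + t) = f l + t • q t := fun t ht => by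
    simp [hq, smul_smul, mul_inv_cancel₀ (hs0 t ht)]
  have hL : ∀ t ∈ s, ∀ r ∈ s, ‖q t - q r‖ ≤ K * |t - r| := fun t ht r hr => by
    simpa [dist_eq_norm] using h.dist_le_mul t ht r hr
  -- If `f l = 0`, the quotient of the norm is ±‖q‖ with a fixed sign on `s`. Otherwise, multiplying
  -- by the conjugate sum writes it as N/D, with N and D Lipschitz, N bounded and D ≥ ‖f l‖ > 0.
  rcases eq_or_ne (f l) 0 with h0 | h0
  · have hval : ∀ t ∈ s, ‖f (l + t)‖ = |t| * ‖q t‖ := fun t ht => by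
      rw [hfq t ht, h0, zero_add, norm_smul, Real.norm_eq_abs]
    refine ⟨K, LipschitzOnWith.of_dist_le_mul fun t ht r hr => ?_⟩
    rw [dist_eq_norm, Real.dist_eq]
    refine le_trans (le_of_eq ?_) ((abs_norm_sub_norm_le _ _).trans (hL t ht r hr))
    rw [h0, norm_zero, sub_zero, sub_zero, hval t ht, hval r hr, smul_eq_mul, smul_eq_mul,
      Real.norm_eq_abs, ← mul_assoc, ← mul_assoc]
    have ht0 := hs0 t ht
    have hr0 := hs0 r hr
    rcases hsign with H | H
    · rw [abs_of_pos (H t ht), abs_of_pos (H r hr), inv_mul_cancel₀ ht0, inv_mul_cancel₀ hr0,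
        one_mul, one_mul]
    · rw [abs_of_neg (H t ht), abs_of_neg (H r hr), mul_neg, mul_neg, inv_mul_cancel₀ ht0,
        inv_mul_cancel₀ hr0, ← abs_neg]
      congr 1
      ring
  · obtain ⟨M, hM0, hM⟩ := h.exists_norm_le hs
    rcases s.eq_empty_or_nonempty with rfl | ⟨s₀, hs₀⟩
    · exact ⟨0, by simp⟩
    have hδ : 0 ≤ δ := (abs_nonneg _).trans (hs s₀ hs₀)
    set β := ‖f l‖ with hβ
    have hβ0 : 0 < β := norm_pos_iff.2 h0
    set N := fun t : ℝ => 2 * inner ℝ (f l) (q t) + t * ‖q t‖ ^ 2 with hN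
    set D := fun t : ℝ => ‖f (l + t)‖ + β with hD
    have hDβ : ∀ t, β ≤ D t := fun t => le_add_of_nonneg_left (norm_nonneg _)
    have hDpos : ∀ t, 0 < D t := fun t => hβ0.trans_le (hDβ t)
    have hval : ∀ t ∈ s, t⁻¹ • (‖f (l + t)‖ - β) = N t / D t := fun t ht => by
      have ht0 := hs0 t ht
      rw [eq_div_iff (hDpos t).ne', smul_eq_mul, mul_assoc, inv_mul_eq_iff_eq_mul₀ ht0]
      have : ‖f (l + t)‖ ^ 2 = β ^ 2 + 2 * (t * inner ℝ (f l) (q t)) + t ^ 2 * ‖q t‖ ^ 2 := by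
        rw [hfq t ht, norm_add_sq_real, norm_smul, real_inner_smul_right, mul_pow,
          Real.norm_eq_abs, sq_abs]
      simp only [hN, hD]
      linear_combination this
    have hqq : ∀ t ∈ s, ∀ r ∈ s, |‖q t‖ - ‖q r‖| ≤ K * |t - r| := fun t ht r hr =>
      (abs_norm_sub_norm_le _ _).trans (hL t ht r hr)
    have hNlip : ∀ t ∈ s, ∀ r ∈ s, |N t - N r| ≤ (2 * β * K + M ^ 2 + δ * (2 * M * K)) * |t - r| := by
      intro t ht r hr
      have e : N t - N r = 2 * inner ℝ (f l) (q t - q r) + (t - r) * ‖q t‖ ^ 2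
          + r * ((‖q t‖ + ‖q r‖) * (‖q t‖ - ‖q r‖)) := by
        simp only [hN, inner_sub_right]
        ring
      have h1 : |2 * inner ℝ (f l) (q t - q r)| ≤ 2 * (β * (K * |t - r|)) := by
        rw [abs_mul, abs_two]
        gcongr
        exact (abs_real_inner_le_norm _ _).trans (by gcongr; exact hL t ht r hr)
      have h2 : |(t - r) * ‖q t‖ ^ 2| ≤ |t - r| * M ^ 2 := by
        rw [abs_mul, abs_of_nonneg (sq_nonneg ‖q t‖)]
        gcongr
        exact hM t ht
      have h3 : |r * ((‖q t‖ + ‖q r‖) * (‖q t‖ - ‖q r‖))| ≤ δ * ((M + M) * (K * |t - r|)) := by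
        rw [abs_mul, abs_mul, abs_of_nonneg (add_nonneg (norm_nonneg (q t)) (norm_nonneg (q r)))]
        gcongr
        · exact hs r hr
        · exact hM t ht
        · exact hM r hr
        · exact hqq t ht r hr
      rw [e]
      refine (abs_add_three _ _ _).trans ((add_le_add_three h1 h2 h3).trans (le_of_eq ?_))
      ring
    have hDlip : ∀ t ∈ s, ∀ r ∈ s, |D t - D r| ≤ (M + δ * K) * |t - r| := by
      intro t ht r hr
      have e : D t - D r = ‖f (l + t)‖ - ‖f (l + r)‖ := by simp only [hD]; ring
      have e2 : f (l + t) - f (l + r) = (t - r) • q t + r • (q t - q r) := by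
        rw [hfq t ht, hfq r hr]
        module
      rw [e]
      refine (abs_norm_sub_norm_le _ _).trans ?_
      rw [e2]
      refine (norm_add_le _ _).trans ?_
      rw [norm_smul (t - r) (q t), norm_smul r (q t - q r), Real.norm_eq_abs, Real.norm_eq_abs]
      have h1 : |t - r| * ‖q t‖ ≤ |t - r| * M := by gcongr; exact hM t ht
      have h2 : |r| * ‖q t - q r‖ ≤ δ * (K * |t - r|) := by
        gcongr
        · exact hs r hr
        · exact hL t ht r hr
      linarith
    have hNb : ∀ t ∈ s, |N t| ≤ 2 * (β * M) + δ * M ^ 2 := by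
      intro t ht
      refine (abs_add_le _ _).trans (add_le_add ?_ ?_)
      · rw [abs_mul, abs_two]
        gcongr
        exact (abs_real_inner_le_norm _ _).trans (by gcongr; exact hM t ht)
      · rw [abs_mul, abs_of_nonneg (sq_nonneg ‖q t‖)]
        gcongr
        · exact hs t ht
        · exact hM t ht
    set c₁ := 2 * β * K + M ^ 2 + δ * (2 * M * K)
    set c₂ := M + δ * K
    set c₃ := 2 * (β * M) + δ * M ^ 2
    have hc₁ : 0 ≤ c₁ := by positivity
    have hc₂ : 0 ≤ c₂ := by positivity
    have hc₃ : 0 ≤ c₃ := by positivity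
    refine ⟨⟨c₁ / β + c₃ * c₂ / (β * β), by positivity⟩,
      LipschitzOnWith.of_dist_le_mul fun t ht r hr => ?_⟩
    rw [Real.dist_eq, Real.dist_eq, hval t ht, hval r hr]
    have e : N t / D t - N r / D r = (N t - N r) / D t - N r * (D t - D r) / (D t * D r) := by
      have := (hDpos t).ne'
      have := (hDpos r).ne'
      field_simp
      ring
    rw [e]
    have h1 : |(N t - N r) / D t| ≤ c₁ * |t - r| / β := by
      rw [abs_div, abs_of_pos (hDpos t)]
      gcongr
      · exact hNlip t ht r hr
      · exact hDβ t
    have h2 : |N r * (D t - D r) / (D t * D r)| ≤ c₃ * (c₂ * |t - r|) / (β * β) := by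
      rw [abs_div, abs_mul, abs_of_pos (mul_pos (hDpos t) (hDpos r))]
      gcongr
      · exact hNb r hr
      · exact hDlip t ht r hr
      · exact hDβ t
      · exact hDβ r
    refine (abs_sub _ _).trans ((add_le_add h1 h2).trans (le_of_eq ?_))
    change _ = (c₁ / β + c₃ * c₂ / (β * β)) * |t - r|
    ring

lemma HasLipschitzSlopeAt.norm {f : ℝ → F} {l : ℝ} (h : HasLipschitzSlopeAt f l) :
    HasLipschitzSlopeAt (fun t => ‖f t‖) l := by
  obtain ⟨K, δ, hδ, h₁, h₂⟩ := h
  obtain ⟨K₁, hK₁⟩ := h₁.norm_slope (δ := δ)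
    (fun t ht => abs_le.2 ⟨by linarith [ht.1], ht.2.le⟩) (Or.inl fun t ht => ht.1)
  obtain ⟨K₂, hK₂⟩ := h₂.norm_slope (δ := δ)
    (fun t ht => abs_le.2 ⟨ht.1.le, by linarith [ht.2]⟩) (Or.inr fun t ht => ht.2)
  exact ⟨max K₁ K₂, δ, hδ, hK₁.weaken (le_max_left _ _), hK₂.weaken (le_max_right _ _)⟩

end LipschitzSlopes

/-! ### Criteria for Lipschitz difference quotients. -/

section LipschitzSlopeCriteria

variable {F G : Type*} [NormedAddCommGroup F] [NormedSpace ℝ F] [NormedAddCommGroup G]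
  [NormedSpace ℝ G]

lemma HasLipschitzSlopeAt.const_sub_clm {f : ℝ → F} {l : ℝ} (h : HasLipschitzSlopeAt f l)
    (T : F →L[ℝ] G) (b : G) {g : ℝ → G} (hl : g l = b - T (f l))
    (hg : ∀ᶠ t in 𝓝 l, g t = b - T (f t)) : HasLipschitzSlopeAt g l := by
  obtain ⟨K, δ, hδ, h₁, h₂⟩ := h
  obtain ⟨η, hη, hη'⟩ := Metric.eventually_nhds_iff.1 hg
  have key : ∀ s : Set ℝ, (∀ t ∈ s, |t| < η) →
      LipschitzOnWith K (fun t : ℝ => t⁻¹ • (f (l + t) - f l)) s →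
      LipschitzOnWith (‖T‖₊ * K) (fun t : ℝ => t⁻¹ • (g (l + t) - g l)) s := by
    intro s hs hL
    have := (-T).lipschitz.comp_lipschitzOnWith hL
    rw [nnnorm_neg] at this
    have e : ∀ t ∈ s, t⁻¹ • (g (l + t) - g l) = (-T) (t⁻¹ • (f (l + t) - f l)) := fun t ht => by
      rw [hη' (y := l + t) (by simpa using hs t ht), hl, map_smul]
      congr 1
      rw [neg_apply, map_sub]
      abel
    intro t ht r hr
    simp only [e t ht, e r hr]
    exact this ht hr
  refine ⟨‖T‖₊ * K, min δ η, lt_min hδ hη, key _ ?_ (h₁.mono ?_), key _ ?_ (h₂.mono ?_)⟩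
  · intro t ht
    exact abs_lt.2 ⟨by linarith [ht.1], ht.2.trans_le (min_le_right _ _)⟩
  · exact Ioo_subset_Ioo_right (min_le_left _ _)
  · intro t ht
    exact abs_lt.2 ⟨by linarith [ht.1, min_le_right δ η], by linarith [ht.2]⟩
  · exact Ioo_subset_Ioo_left (neg_le_neg (min_le_left _ _))

lemma HasLipschitzSlopeAt.congr {f g : ℝ → F} {l : ℝ} (h : HasLipschitzSlopeAt f l)
    (hfg : g =ᶠ[𝓝 l] f) : HasLipschitzSlopeAt g l :=
  h.const_sub_clm (-ContinuousLinearMap.id ℝ F) 0 (by simpa using hfg.self_of_nhds)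
    (hfg.mono fun t ht => by simpa using ht)

/-- A pointwise bound on the variation of the difference quotient, uniform in the point. -/
lemma hasLipschitzSlopeAt_of_eventually {f : ℝ → F} {l δ : ℝ} (hδ : 0 < δ) {C : NNReal}
    (h : ∀ s : ℝ, s ≠ 0 → |s| < δ → ∀ᶠ t in 𝓝 s,
      ‖s • (f (l + t) - f l) - t • (f (l + s) - f l)‖ ≤ C * s ^ 2 * |t - s|) :
    HasLipschitzSlopeAt f l := by
  have key : ∀ s : ℝ, s ≠ 0 → |s| < δ → ∀ᶠ t in 𝓝 s,
      ‖t⁻¹ • (f (l + t) - f l) - s⁻¹ • (f (l + s) - f l)‖ ≤ (2 * C : NNReal) * |t - s| := by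
    intro s hs0 hs
    -- Division by |t||s| then costs at most the factor 2 in the constant.
    have hhalf : ∀ᶠ t in 𝓝 s, |s| / 2 < |t| :=
      (continuous_abs.tendsto s).eventually_const_lt (half_lt_self (abs_pos.2 hs0))
    filter_upwards [h s hs0 hs, hhalf] with t ht htpos
    have hs' : 0 < |s| := abs_pos.2 hs0
    have ht' : 0 < |t| := by linarith
    have ht0 : t ≠ 0 := abs_pos.1 ht'
    have e : t⁻¹ • (f (l + t) - f l) - s⁻¹ • (f (l + s) - f l)
        = (t * s)⁻¹ • (s • (f (l + t) - f l) - t • (f (l + s) - f l)) := by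
      have e1 : t⁻¹ = (t * s)⁻¹ * s := by field_simp
      have e2 : s⁻¹ = (t * s)⁻¹ * t := by field_simp
      rw [smul_sub (t * s)⁻¹, smul_smul, smul_smul, ← e1, ← e2]
    rw [e, norm_smul, norm_inv, norm_mul, Real.norm_eq_abs, Real.norm_eq_abs,
      inv_mul_le_iff₀ (by positivity)]
    refine ht.trans ?_
    rw [← sq_abs s, NNReal.coe_mul, NNReal.coe_ofNat]
    have hC : (0 : ℝ) ≤ C := C.2
    have : |s| * |s| ≤ 2 * (|t| * |s|) := by nlinarith
    calc (C : ℝ) * |s| ^ 2 * |t - s| = (|s| * |s|) * (C * |t - s|) := by ring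
      _ ≤ (2 * (|t| * |s|)) * (C * |t - s|) := by gcongr
      _ = _ := by ring
  refine ⟨2 * C, δ, hδ, lipschitzOnWith_Ioo_of_eventually fun s hs => key s hs.1.ne' ?_,
    lipschitzOnWith_Ioo_of_eventually fun s hs => key s hs.2.ne ?_⟩
  · exact abs_lt.2 ⟨by linarith [hs.1], hs.2⟩
  · exact abs_lt.2 ⟨hs.1, by linarith [hs.2]⟩

/-- The difference quotients of a piecewise affine function of one variable at a point take
finitely many values nearby, hence are constant on each side. -/
lemma IsPiecewiseAffineOn.hasLipschitzSlopeAt {f : ℝ → F} {D : Set ℝ} (hD : IsOpen D)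
    (h : IsPiecewiseAffineOn f D) {l : ℝ} (hl : l ∈ D) : HasLipschitzSlopeAt f l := by
  obtain ⟨hcont, k, G, hG⟩ := h
  have hGc : ∀ i, Continuous (G i) := fun i => (G i).continuous_of_finiteDimensional
  -- By continuity, a piece used near `l` already agrees with `f` at `l`; the quotient there is thus
  -- the slope of that piece. A continuous function with finitely many values is constant on an
  -- interval.
  have hev : ∀ᶠ t in 𝓝 l, t ∈ D ∧ ∀ i, f t = G i t → f l = G i l := by
    refine (hD.eventually_mem hl).and (eventually_all.2 fun i => ?_)
    by_cases hi : f l = G i l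
    · exact Eventually.of_forall fun _ _ => hi
    · have hne : ∀ᶠ t in 𝓝 l, f t - G i t ≠ 0 :=
        ((hcont.continuousAt (hD.mem_nhds hl)).sub (hGc i).continuousAt).eventually_ne
          (sub_ne_zero.2 hi)
      filter_upwards [hne] with t ht h using absurd (sub_eq_zero.2 h) ht
  obtain ⟨δ, hδ, hball⟩ := Metric.eventually_nhds_iff.1 hev
  have hball' : ∀ t : ℝ, |t| < δ → l + t ∈ D ∧ ∀ i, f (l + t) = G i (l + t) → f l = G i l :=
    fun t ht => hball (by simpa using ht)
  set T : Set F := range fun i => (G i).linear 1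
  have key : ∀ s : Set ℝ, IsPreconnected s → s.Nonempty → (∀ t ∈ s, |t| < δ ∧ t ≠ 0) →
      LipschitzOnWith 0 (fun t : ℝ => t⁻¹ • (f (l + t) - f l)) s := by
    intro s hs hne hsub
    have hmaps : MapsTo (fun t : ℝ => t⁻¹ • (f (l + t) - f l)) s T := by
      intro t ht
      obtain ⟨htD, hti⟩ := hball' t (hsub t ht).1
      obtain ⟨i, hi⟩ := hG _ htD
      refine ⟨i, ?_⟩
      have e : l + t = t +ᵥ l := by rw [vadd_eq_add, add_comm]
      simp only
      rw [hi, hti i hi, e, AffineMap.map_vadd, vadd_eq_add, add_sub_cancel_right,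
        ← map_smul, smul_eq_mul, inv_mul_cancel₀ (hsub t ht).2]
    have hq : ContinuousOn (fun t : ℝ => t⁻¹ • (f (l + t) - f l)) s := by
      refine (continuousOn_inv₀.mono fun t ht => (hsub t ht).2).smul ?_
      refine (hcont.comp (by fun_prop) fun t ht => (hball' t (hsub t ht).1).1).sub
        continuousOn_const
    obtain ⟨v, -, hv⟩ := hs.eqOn_const_of_mapsTo (finite_range _).isDiscrete hq hmaps
      (hne.image _ |>.mono hmaps.image_subset)
    refine LipschitzOnWith.of_dist_le_mul fun t ht r hr => ?_
    have h1 := hv ht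
    have h2 := hv hr
    simp only [Function.const_apply] at h1 h2
    rw [h1, h2]
    simp
  refine ⟨0, δ, hδ, key _ isPreconnected_Ioo (nonempty_Ioo.2 hδ) fun t ht => ?_,
    key _ isPreconnected_Ioo (nonempty_Ioo.2 (by linarith)) fun t ht => ?_⟩
  · exact ⟨abs_lt.2 ⟨by linarith [ht.1], ht.2⟩, ht.1.ne'⟩
  · exact ⟨abs_lt.2 ⟨ht.1, by linarith [ht.2]⟩, ht.2.ne⟩

end LipschitzSlopeCriteria

/-! ### KKT conditions and the projected residual equation. -/

section OptimalityConditions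

variable {X Y : Type*} [NormedAddCommGroup X] [InnerProductSpace ℝ X] [CompleteSpace X]
  [NormedAddCommGroup Y] [InnerProductSpace ℝ Y] [CompleteSpace Y]

/-- The optimality conditions of `min ½‖Ax - b‖² + l σ_C(x)`, where `σ_C` is the support function
of `C`: the vector `l⁻¹ Aᵀ(b - Ax)` belongs to `C` and exposes `x`. -/
structure IsKKTPoint (C : Set X) (A : X →L[ℝ] Y) (b : Y) (x : X) (l : ℝ) : Prop where
  mem : l⁻¹ • A.adjoint (b - A x) ∈ C
  le : ∀ c ∈ C, inner ℝ c x ≤ inner ℝ (l⁻¹ • A.adjoint (b - A x)) x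

variable {C : Set X} {A : X →L[ℝ] Y} {b : Y}

/-- This is the variational inequality of the projection of l⁻¹b onto {v | A*v ∈ C}. That set does
not depend on l, which is the source of Lipschitz dependence on the parameter. -/
lemma IsKKTPoint.inner_le {x : X} {l : ℝ} (hl : 0 < l) (h : IsKKTPoint C A b x l) {v : Y}
    (hv : A.adjoint v ∈ C) :
    inner ℝ (l⁻¹ • b - l⁻¹ • (b - A x)) (v - l⁻¹ • (b - A x)) ≤ 0 := by
  have h1 := h.le _ hv
  rw [← map_smul, ContinuousLinearMap.adjoint_inner_left,
    ContinuousLinearMap.adjoint_inner_left] at h1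
  rw [← smul_sub, sub_sub_cancel, real_inner_smul_left, real_inner_comm, inner_sub_left]
  exact mul_nonpos_of_nonneg_of_nonpos (inv_nonneg.2 hl.le) (sub_nonpos.2 h1)

/-- The residuals of KKT points depend on the parameter in a locally Lipschitz way. -/
lemma IsKKTPoint.norm_sub_le {x₁ x₂ : X} {l₁ l₂ : ℝ} (hl₁ : 0 < l₁) (hl₂ : 0 < l₂)
    (h₁ : IsKKTPoint C A b x₁ l₁) (h₂ : IsKKTPoint C A b x₂ l₂) (h0 : (0 : X) ∈ C) :
    ‖(b - A x₁) - (b - A x₂)‖ ≤ 2 * ‖b‖ / l₂ * |l₁ - l₂| := by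
  set v₁ := l₁⁻¹ • (b - A x₁) with hv₁
  set v₂ := l₂⁻¹ • (b - A x₂) with hv₂
  have m₁ : A.adjoint v₁ ∈ C := by rw [hv₁, map_smul]; exact h₁.mem
  have m₂ : A.adjoint v₂ ∈ C := by rw [hv₂, map_smul]; exact h₂.mem
  have hb : ‖v₂‖ ≤ l₂⁻¹ * ‖b‖ := by
    -- Since 0 ∈ C, the origin is feasible and is its own projection.
    have := norm_sub_le_of_inner_le (w₁ := l₂⁻¹ • b) (w₂ := 0) (v₁ := v₂) (v₂ := 0)
      (h₂.inner_le hl₂ (by simpa using h0)) (by simp)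
    simpa [norm_smul, abs_of_pos hl₂] using this
  have hv : ‖v₁ - v₂‖ ≤ |l₁⁻¹ - l₂⁻¹| * ‖b‖ := by
    have := norm_sub_le_of_inner_le (h₁.inner_le hl₁ m₂) (h₂.inner_le hl₂ m₁)
    rwa [← sub_smul, norm_smul, Real.norm_eq_abs] at this
  have e : (b - A x₁) - (b - A x₂) = l₁ • (v₁ - v₂) + (l₁ - l₂) • v₂ := by
    have e₁ : b - A x₁ = l₁ • v₁ := by rw [hv₁, smul_smul, mul_inv_cancel₀ hl₁.ne', one_smul]
    have e₂ : b - A x₂ = l₂ • v₂ := by rw [hv₂, smul_smul, mul_inv_cancel₀ hl₂.ne', one_smul]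
    rw [e₁, e₂]
    module
  rw [e]
  refine (norm_add_le _ _).trans ?_
  rw [norm_smul, norm_smul, Real.norm_eq_abs, Real.norm_eq_abs, abs_of_pos hl₁]
  have hinv : |l₁⁻¹ - l₂⁻¹| = l₁⁻¹ * l₂⁻¹ * |l₁ - l₂| := by
    have : l₁⁻¹ - l₂⁻¹ = l₁⁻¹ * l₂⁻¹ * (l₂ - l₁) := by field_simp
    rw [this, abs_mul, abs_of_pos (by positivity), abs_sub_comm]
  rw [hinv] at hv
  calc l₁ * ‖v₁ - v₂‖ + |l₁ - l₂| * ‖v₂‖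
      ≤ l₁ * (l₁⁻¹ * l₂⁻¹ * |l₁ - l₂| * ‖b‖) + |l₁ - l₂| * (l₂⁻¹ * ‖b‖) := by gcongr
    _ = 2 * ‖b‖ / l₂ * |l₁ - l₂| := by field_simp; ring

lemma IsKKTPoint.locallyLipschitzOn {x : ℝ → X} (h0 : (0 : X) ∈ C)
    (h : ∀ l : ℝ, 0 < l → IsKKTPoint C A b (x l) l) {y : ℝ → Y}
    (hy : ∀ l : ℝ, 0 < l → y l = b - A (x l)) : LocallyLipschitzOn (Ioi 0) y := by
  intro l hl
  have hl' : (0 : ℝ) < l := hl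
  refine ⟨⟨2 * ‖b‖ / (l / 2), by positivity⟩, Ioi (l / 2),
    mem_nhdsWithin_of_mem_nhds (Ioi_mem_nhds (half_lt_self hl')),
    LipschitzOnWith.of_dist_le_mul fun r hr t ht => ?_⟩
  have hr0 : 0 < r := (half_pos hl').trans hr
  have ht0 : 0 < t := (half_pos hl').trans ht
  rw [dist_eq_norm, hy r hr0, hy t ht0, Real.dist_eq]
  refine ((h r hr0).norm_sub_le hr0 ht0 (h t ht0) h0).trans ?_
  change _ ≤ 2 * ‖b‖ / (l / 2) * _
  gcongr
  exact le_of_lt ht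

lemma nonneg_of_forall_quadratic_nonneg {a c δ : ℝ} (hδ : 0 < δ)
    (h : ∀ τ ∈ Ioo 0 δ, 0 ≤ τ * a + τ ^ 2 * c) : 0 ≤ a := by
  have hlim : Tendsto (fun τ : ℝ => a + τ * c) (𝓝[>] 0) (𝓝 a) := by
    have : Continuous fun τ : ℝ => a + τ * c := by fun_prop
    simpa using (this.tendsto 0).mono_left nhdsWithin_le_nhds
  refine ge_of_tendsto hlim ?_
  filter_upwards [Ioo_mem_nhdsGT hδ] with τ hτ
  have := h τ hτ
  have e : τ * a + τ ^ 2 * c = τ * (a + τ * c) := by ring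
  rw [e] at this
  exact nonneg_of_mul_nonneg_right this hτ.1

/-- First-order optimality along a feasible direction. -/
lemma inner_add_nonneg_of_feasible_direction {X Y : Type*} [NormedAddCommGroup X]
    [NormedSpace ℝ X] [NormedAddCommGroup Y] [InnerProductSpace ℝ Y] {A : X →L[ℝ] Y} {b : Y} {S : Set (X × ℝ)} {x : X} {s l δ : ℝ}
    (hmin : ∀ z ∈ S, 1 / 2 * ‖A x - b‖ ^ 2 + l * s ≤ 1 / 2 * ‖A z.1 - b‖ ^ 2 + l * z.2)
    (hδ : 0 < δ) {v : X × ℝ} (hv : ∀ τ ∈ Ioo 0 δ, (x, s) + τ • v ∈ S) :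
    0 ≤ inner ℝ (A x - b) (A v.1) + l * v.2 := by
  refine nonneg_of_forall_quadratic_nonneg (c := 1 / 2 * ‖A v.1‖ ^ 2) hδ fun τ hτ => ?_
  have h := hmin _ (hv τ hτ)
  have e : A ((x, s) + τ • v).1 - b = (A x - b) + τ • A v.1 := by
    simp only [Prod.fst_add, Prod.smul_fst, map_add, map_smul]
    abel
  rw [e, norm_add_sq_real, real_inner_smul_right, norm_smul, mul_pow, Real.norm_eq_abs,
    sq_abs] at h
  simp only [Prod.snd_add, Prod.smul_snd, smul_eq_mul] at h
  linarith

/-- The epigraph is a convex cone: moving from `(x, s)` along any of its elements gives membership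
in the subdifferential, and moving toward the apex gives the exposing inequality. -/
lemma isKKTPoint_of_epigraph_minimizer {p : X → EReal} (hp : IsGaugeFunction p) {x : X} {s l : ℝ}
    (hl : 0 < l) (hx : (x, s) ∈ epigraph p)
    (hmin : ∀ z ∈ epigraph p,
      1 / 2 * ‖A x - b‖ ^ 2 + l * s ≤ 1 / 2 * ‖A z.1 - b‖ ^ 2 + l * z.2) :
    IsKKTPoint (subdifferential p 0) A b x l := by
  have hmem : l⁻¹ • A.adjoint (b - A x) ∈ subdifferential p 0 := by
    rw [hp.mem_subdifferential_zero_iff]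
    intro z hz
    have := inner_add_nonneg_of_feasible_direction hmin one_pos (v := z)
      fun τ hτ => hp.add_mem hx (hp.smul_mem hz hτ.1)
    rw [real_inner_smul_left, ContinuousLinearMap.adjoint_inner_left, inv_mul_le_iff₀ hl]
    rw [← neg_sub b, inner_neg_left] at this
    linarith
  refine ⟨hmem, fun c hc => (hp.mem_subdifferential_zero_iff.1 hc _ hx).trans ?_⟩
  have := inner_add_nonneg_of_feasible_direction hmin one_pos (v := -(x, s)) fun τ hτ => by
    have e : (x, s) + τ • -(x, s) = (1 - τ) • (x, s) := by module
    rw [e]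
    exact hp.smul_mem hx (sub_pos.2 hτ.2)
  rw [real_inner_smul_left, ContinuousLinearMap.adjoint_inner_left, le_inv_mul_iff₀ hl]
  rw [← neg_sub b, inner_neg_left] at this
  simp only [Prod.fst_neg, Prod.snd_neg, map_neg, inner_neg_right] at this
  linarith

/-- The argument of the proximal mapping in the proximal residual. -/
def gradientStep (A : X →L[ℝ] Y) (b : Y) (z : X × ℝ) : X :=
  z.1 + z.2⁻¹ • A.adjoint (b - A z.1)

/-- The proximal residual, written through the projection onto `C`. -/
def projectionResidual (C : Set X) (A : X →L[ℝ] Y) (b : Y) (z : X × ℝ) : X :=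
  z.1 - gradientStep A b z + metricProjection C (gradientStep A b z)

/-- With u = l⁻¹A*(b - Ax) the equation reads Π_C(x + u) = u, whose variational inequality is the
KKT condition. -/
lemma projectionResidual_eq_zero_iff (hne : C.Nonempty) (hcl : IsClosed C) (hconv : Convex ℝ C)
    {x : X} {l : ℝ} : projectionResidual C A b (x, l) = 0 ↔ IsKKTPoint C A b x l := by
  set u := l⁻¹ • A.adjoint (b - A x) with hu
  have e : projectionResidual C A b (x, l) = metricProjection C (x + u) - u := by
    simp only [projectionResidual, gradientStep, ← hu]
    abel
  rw [e, sub_eq_zero]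
  constructor
  · intro h
    obtain ⟨h1, h2⟩ := metricProjection_spec hne hcl hconv (x + u)
    rw [h] at h1 h2
    refine ⟨h1, fun c hc => ?_⟩
    have := h2 c hc
    rw [add_sub_cancel_right, real_inner_comm, inner_sub_left] at this
    linarith
  · rintro ⟨h1, h2⟩
    refine metricProjection_eq h1 fun c hc => ?_
    have := h2 c hc
    rw [add_sub_cancel_right, real_inner_comm, inner_sub_left]
    linarith

end OptimalityConditions

/-! ### Translation of the matrix problem and its dual. -/

section Euclidean

variable {m n : ℕ}

/-- The continuous linear map of a matrix between Euclidean spaces. -/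
def euclideanCLM (A : Matrix (Fin m) (Fin n) ℝ) :
    EuclideanSpace ℝ (Fin n) →L[ℝ] EuclideanSpace ℝ (Fin m) :=
  LinearMap.toContinuousLinearMap (Matrix.toEuclideanLin A)

lemma toEuclideanLin_apply_eq (A : Matrix (Fin m) (Fin n) ℝ) (x : EuclideanSpace ℝ (Fin n)) :
    Matrix.toEuclideanLin A x = euclideanCLM A x := rfl

lemma toEuclideanLin_transpose_apply_eq (A : Matrix (Fin m) (Fin n) ℝ)
    (y : EuclideanSpace ℝ (Fin m)) :
    Matrix.toEuclideanLin A.transpose y = (euclideanCLM A).adjoint y := by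
  have h := Matrix.toEuclideanLin_conjTranspose_eq_adjoint A
  rw [Matrix.conjTranspose_eq_transpose_of_trivial] at h
  rw [h]
  rfl

variable {p : EuclideanSpace ℝ (Fin n) → EReal} {A : Matrix (Fin m) (Fin n) ℝ}
  {b : EuclideanSpace ℝ (Fin m)}

lemma hasGradientAt_leastSquares (x : EuclideanSpace ℝ (Fin n)) :
    HasGradientAt (leastSquares A b) (-(euclideanCLM A).adjoint (b - euclideanCLM A x)) x := by
  rw [hasGradientAt_iff_hasFDerivAt]
  have h1 : HasFDerivAt (fun x => euclideanCLM A x - b) (euclideanCLM A) x :=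
    (euclideanCLM A).hasFDerivAt.sub_const b
  have h2 := h1.norm_sq.const_mul (1 / 2 : ℝ)
  refine h2.congr_fderiv ?_
  ext v
  simp only [InnerProductSpace.toDual_apply_apply, inner_neg_left,
    ContinuousLinearMap.adjoint_inner_left]
  rw [← inner_neg_left, neg_sub]
  simp [inner_sub_left]

lemma proxResidual_eq (hp : IsGaugeFunction p) (hc : LowerSemicontinuous p) :
    proxResidual p A b = projectionResidual (subdifferential p 0) (euclideanCLM A) b := by
  ext1 z
  have e : z.1 - z.2⁻¹ • gradient (leastSquares A b) z.1
      = gradientStep (euclideanCLM A) b z := by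
    rw [(hasGradientAt_leastSquares z.1).gradient, gradientStep, smul_neg, sub_neg_eq_add]
  rw [proxResidual, projectionResidual, e, hp.prox_eq hc]
  abel

lemma exists_epigraph_minimizer (hp : IsGaugeFunction p) {l : ℝ} (hl : 0 < l)
    {x : EuclideanSpace ℝ (Fin n)} (hx : x ∈ primalSolutions p A b l) :
    ∃ s, (x, s) ∈ epigraph p ∧ ∀ z ∈ epigraph p,
      1 / 2 * ‖euclideanCLM A x - b‖ ^ 2 + l * s
        ≤ 1 / 2 * ‖euclideanCLM A z.1 - b‖ ^ 2 + l * z.2 := by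
  have hl' : (0 : EReal) ≤ (l : EReal) := by exact_mod_cast hl.le
  induction hq : p x with
  | bot => exact absurd hq (hp.ne_bot x)
  | top =>
    have := hx 0
    rw [hq, hp.map_zero, mul_zero, add_zero, EReal.coe_mul_top_of_pos hl, EReal.coe_add_top] at this
    exact absurd this (not_le.2 (EReal.coe_lt_top _))
  | coe s =>
    refine ⟨s, hq.le, fun z hz => ?_⟩
    have h1 := hx z.1
    have h2 : (leastSquares A b z.1 : EReal) + (l : EReal) * p z.1
        ≤ (leastSquares A b z.1 : EReal) + (l : EReal) * (z.2 : EReal) :=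
      add_le_add_right (mul_le_mul_of_nonneg_left (show p z.1 ≤ _ from hz) hl') _
    have h3 := h1.trans h2
    rw [hq] at h3
    exact_mod_cast h3

/-- Comparison with (0, 0) forces u ∈ ∂p(0). The objective is then -½‖y - b‖² up to a constant, and
b - Ax satisfies the obtuse-angle inequality against every such feasible y, so it is the nearest one
to b. -/
lemma dual_solution_eq (hp : IsGaugeFunction p) {l : ℝ} (hl : 0 < l)
    {x : EuclideanSpace ℝ (Fin n)}
    (hx : IsKKTPoint (subdifferential p 0) (euclideanCLM A) b x l)
    {y : EuclideanSpace ℝ (Fin m)} {u : EuclideanSpace ℝ (Fin n)}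
    (h : IsDualSolution p A b l y u) : y = b - euclideanCLM A x := by
  obtain ⟨hfeas, hmax⟩ := h
  simp only [toEuclideanLin_transpose_apply_eq] at hfeas hmax
  have hobj : ∀ y' u', u' ∈ subdifferential p 0 → dualObjective p b l y' u'
      = ((-(1 / 2) * ‖y'‖ ^ 2 + inner ℝ b y' : ℝ) : EReal) := fun y' u' hu' => by
    rw [dualObjective, hp.fenchelConjugate_eq_zero hu', mul_zero, sub_zero]
  have hu : u ∈ subdifferential p 0 := by
    by_contra hu
    have := hmax 0 0 (by simp)
    rw [hobj _ _ hp.zero_mem_subdifferential, dualObjective, hp.fenchelConjugate_eq_top hu,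
      EReal.coe_mul_top_of_pos hl, EReal.sub_top] at this
    simp at this
  set A' := euclideanCLM A
  set y₀ := b - A' x with hy₀
  have h1 := hmax y₀ (l⁻¹ • A'.adjoint y₀) (by
    rw [smul_smul, mul_inv_cancel₀ hl.ne', one_smul, sub_self])
  rw [hobj _ _ hu, hobj _ _ hx.mem, EReal.coe_le_coe_iff] at h1
  have h2 : inner ℝ (b - y₀) (y - y₀) ≤ 0 := by
    have h3 := hx.le u hu
    have h4 : A'.adjoint y = l • u := sub_eq_zero.1 hfeas
    have h5 : inner ℝ y (A' x) = l * inner ℝ u x := by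
      rw [← ContinuousLinearMap.adjoint_inner_left, h4, real_inner_smul_left]
    rw [real_inner_smul_left, ContinuousLinearMap.adjoint_inner_left, le_inv_mul_iff₀ hl] at h3
    rw [hy₀, sub_sub_cancel, ← hy₀, real_inner_comm, inner_sub_left, h5]
    exact sub_nonpos.2 h3
  have h6 := norm_sub_sq_le_of_inner_le h2
  have h7 : ∀ a : EuclideanSpace ℝ (Fin m), ‖a - b‖ ^ 2 = ‖a‖ ^ 2 - 2 * inner ℝ b a + ‖b‖ ^ 2 :=
    fun a => by rw [norm_sub_sq_real, real_inner_comm]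
  rw [h7, h7] at h6
  have h8 : ‖y - y₀‖ ^ 2 ≤ 0 := by linarith
  exact sub_eq_zero.1 (norm_eq_zero.1 (pow_eq_zero_iff two_ne_zero |>.1
    (le_antisymm h8 (sq_nonneg _))))

end Euclidean

/-! ### Second-order estimate for smooth maps. -/

section Calculus

variable {X Y : Type*} [NormedAddCommGroup X] [NormedSpace ℝ X] [NormedAddCommGroup Y]
  [NormedSpace ℝ Y]

/-- A twice continuously differentiable map satisfies the estimate of strong semismoothness. -/
lemma ContDiffAt.exists_second_order_estimate {f : X → Y} {x : X} (hf : ContDiffAt ℝ 2 f x) :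
    ∃ C : ℝ, 0 ≤ C ∧ ∀ᶠ z in 𝓝 x, ‖f z - f x - fderiv ℝ f z (z - x)‖ ≤ C * ‖z - x‖ ^ 2 := by
  obtain ⟨K, t, ht, hK⟩ := (hf.fderiv_right (m := 1) (by norm_num)).exists_lipschitzOnWith
  have hd : ∀ᶠ z in 𝓝 x, DifferentiableAt ℝ f z :=
    (hf.eventually (by simp)).mono fun z hz => hz.differentiableAt (by norm_num)
  obtain ⟨ε, hε, hball⟩ := Metric.eventually_nhds_iff_ball.1 (hd.and ht)
  refine ⟨K * 2, by positivity, ?_⟩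
  filter_upwards [Metric.ball_mem_nhds x hε] with z hz
  set r := ‖z - x‖ with hr
  have hsub : Metric.closedBall x r ⊆ Metric.ball x ε :=
    Metric.closedBall_subset_ball (by rwa [hr, ← dist_eq_norm])
  have hzr : z ∈ Metric.closedBall x r := by rw [mem_closedBall_iff_norm]
  have := (convex_closedBall x r).norm_image_sub_le_of_norm_fderiv_le' (f := f) (𝕜 := ℝ)
    (φ := fderiv ℝ f z) (C := K * (2 * r)) (x := x) (y := z)
    (fun a ha => (hball a (hsub ha)).1) (fun a ha => ?_)
    (Metric.mem_closedBall_self (norm_nonneg _)) hzr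
  · refine this.trans (le_of_eq ?_)
    rw [← hr]
    ring
  · rw [← dist_eq_norm]
    refine (hK.dist_le_mul a (hball a (hsub ha)).2 z (hball z hz).2).trans ?_
    gcongr
    refine (dist_triangle_right a z x).trans ?_
    have h1 := Metric.mem_closedBall.1 ha
    have h2 := Metric.mem_closedBall.1 hzr
    linarith

end Calculus

/-! ### Limiting Jacobians: existence, semismooth estimate, uniform nondegeneracy. -/

section LimitingJacobian

variable {X Y : Type*} [NormedAddCommGroup X] [InnerProductSpace ℝ X] [FiniteDimensional ℝ X]
  [NormedAddCommGroup Y] [InnerProductSpace ℝ Y] [FiniteDimensional ℝ Y]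
  {C : Set X} {A : X →L[ℝ] Y} {b : Y}

lemma contDiffAt_gradientStep {z : X × ℝ} (hz : 0 < z.2) :
    ContDiffAt ℝ 2 (gradientStep A b) z := by
  have h : ContDiffAt ℝ 2 (fun z : X × ℝ => z.2⁻¹) z := contDiffAt_snd.inv hz.ne'
  have h2 : ContDiff ℝ 2 (fun z : X × ℝ => A.adjoint (b - A z.1)) := by fun_prop
  exact contDiffAt_fst.add (h.smul h2.contDiffAt)

/-- The points at which the proximal residual is differentiable because the projection is
differentiable at the gradient step. -/
def regularPoints (C : Set X) (A : X →L[ℝ] Y) (b : Y) : Set (X × ℝ) :=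
  {z | 0 < z.2 ∧ DifferentiableAt ℝ (metricProjection C) (gradientStep A b z)}

lemma dense_differentiableAt_of_lipschitzWith {f : X → X} {K : NNReal} (hf : LipschitzWith K f) :
    Dense {x | DifferentiableAt ℝ f x} := by
  let _ : MeasurableSpace X := borel X
  have : BorelSpace X := ⟨rfl⟩
  exact MeasureTheory.Measure.dense_of_ae
    (hf.ae_differentiableAt (μ := MeasureTheory.Measure.addHaar))

/-- For l outside the finite spectrum of A*A, x ↦ `gradientStep A b (x, l)` is an affine bijection,
hence open, and pulls the dense set given by Rademacher's theorem back to a dense set. Perturbing l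
slightly avoids the spectrum. -/
lemma mem_closure_regularPoints (hne : C.Nonempty) (hcl : IsClosed C) (hconv : Convex ℝ C)
    {z : X × ℝ} (hz : 0 < z.2) : z ∈ closure (regularPoints C A b) := by
  rw [Metric.mem_closure_iff]
  intro ε hε
  set B : X →ₗ[ℝ] X := (A.adjoint ∘L A).toLinearMap with hB
  have hinf : (Ioo z.2 (z.2 + ε)).Infinite := Ioo_infinite (by linarith)
  obtain ⟨l, hl, hlB⟩ := hinf.exists_notMem_finite (Module.End.finite_hasEigenvalue B)
  have hl0 : 0 < l := hz.trans hl.1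
  set T : X →L[ℝ] X := ContinuousLinearMap.id ℝ X - l⁻¹ • (A.adjoint ∘L A) with hT
  have hinj : Function.Injective T := by
    rw [injective_iff_map_eq_zero]
    intro d hd
    by_contra hd0
    refine hlB (Module.End.hasEigenvalue_of_hasEigenvector (x := d)
      (Module.End.hasEigenvector_iff.2 ⟨Module.End.mem_eigenspace_iff.2 ?_, hd0⟩))
    have h1 : d = l⁻¹ • A.adjoint (A d) := sub_eq_zero.1 hd
    change A.adjoint (A d) = l • d
    nth_rewrite 2 [h1]
    rw [smul_smul, mul_inv_cancel₀ hl0.ne', one_smul]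
  have hsurj : Function.Surjective T :=
    LinearMap.injective_iff_surjective (f := (T : X →ₗ[ℝ] X)).1 hinj
  have hg : ∀ a : X, gradientStep A b (a, l) = T a + l⁻¹ • A.adjoint b := fun a => by
    simp only [gradientStep, hT, map_sub, smul_sub]
    change _ = (a - l⁻¹ • A.adjoint (A a)) + _
    abel
  have hopen : IsOpenMap fun a : X => T a + l⁻¹ • A.adjoint b :=
    (Homeomorph.addRight _).isOpenMap.comp (T.isOpenMap hsurj)
  have hdense := (dense_differentiableAt_of_lipschitzWith
    (lipschitzWith_metricProjection hne hcl hconv)).preimage hopen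
  obtain ⟨a, ha, hda⟩ := hdense.exists_dist_lt z.1 hε
  refine ⟨(a, l), ⟨hl0, ?_⟩, ?_⟩
  · rw [hg]
    exact ha
  · rw [Prod.dist_eq]
    refine max_lt hda ?_
    rw [Real.dist_eq, abs_sub_comm, abs_of_pos (sub_pos.2 hl.1)]
    linarith [hl.2]

/-- The limits of derivatives of the proximal residual at regular points. -/
def limitingJacobian (C : Set X) (A : X →L[ℝ] Y) (b : Y) (z : X × ℝ) : Set (X × ℝ →L[ℝ] X) :=
  {V | ∃ s : ℕ → X × ℝ, Tendsto s atTop (𝓝 z) ∧ (∀ k, s k ∈ regularPoints C A b) ∧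
    Tendsto (fun k => fderiv ℝ (projectionResidual C A b) (s k)) atTop (𝓝 V)}

lemma hasFDerivAt_projectionResidual {z : X × ℝ} (hz : z ∈ regularPoints C A b) :
    HasFDerivAt (projectionResidual C A b)
      (ContinuousLinearMap.fst ℝ X ℝ - fderiv ℝ (gradientStep A b) z
        + (fderiv ℝ (metricProjection C) (gradientStep A b z)) ∘L
          fderiv ℝ (gradientStep A b) z) z := by
  have h1 : HasFDerivAt (gradientStep A b) (fderiv ℝ (gradientStep A b) z) z :=
    ((contDiffAt_gradientStep hz.1).differentiableAt (by norm_num)).hasFDerivAt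
  exact (hasFDerivAt_fst.sub h1).add (hz.2.hasFDerivAt.comp z h1)

lemma exists_lipschitzOnWith_projectionResidual (hne : C.Nonempty) (hcl : IsClosed C)
    (hconv : Convex ℝ C) {z : X × ℝ} (hz : 0 < z.2) :
    ∃ K : NNReal, ∃ t ∈ 𝓝 z, LipschitzOnWith K (projectionResidual C A b) t := by
  obtain ⟨K, t, ht, hK⟩ :=
    ((contDiffAt_gradientStep (A := A) (b := b) hz).of_le (m := 1)
      (by norm_num)).exists_lipschitzOnWith
  have hP := (lipschitzWith_metricProjection hne hcl hconv).comp_lipschitzOnWith hK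
  exact ⟨_, t, ht, (LipschitzWith.prod_fst.lipschitzOnWith.sub hK).add hP⟩

lemma continuousAt_projectionResidual (hne : C.Nonempty) (hcl : IsClosed C)
    (hconv : Convex ℝ C) {z : X × ℝ} (hz : 0 < z.2) :
    ContinuousAt (projectionResidual C A b) z := by
  obtain ⟨K, t, ht, hK⟩ :=
    exists_lipschitzOnWith_projectionResidual (A := A) (b := b) hne hcl hconv hz
  exact hK.continuousOn.continuousAt ht

lemma exists_eventually_norm_fderiv_le (hne : C.Nonempty) (hcl : IsClosed C)
    (hconv : Convex ℝ C) {z₀ : X × ℝ} (hz₀ : 0 < z₀.2) :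
    ∃ L : ℝ, 0 ≤ L ∧ ∀ᶠ z in 𝓝 z₀, ‖fderiv ℝ (projectionResidual C A b) z‖ ≤ L := by
  obtain ⟨K, t, ht, hK⟩ :=
    exists_lipschitzOnWith_projectionResidual (A := A) (b := b) hne hcl hconv hz₀
  refine ⟨K, K.2, ?_⟩
  filter_upwards [eventually_mem_nhds_iff.2 ht] with z hz
    using norm_fderiv_le_of_lipschitzOn ℝ hz hK

lemma eventually_pos_snd {X : Type*} [TopologicalSpace X] {z₀ : X × ℝ} (hz₀ : 0 < z₀.2) : ∀ᶠ z in 𝓝 z₀, 0 < z.2 :=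
  continuous_snd.continuousAt.eventually_const_lt hz₀

lemma exists_eventually_norm_le_of_mem_limitingJacobian (hne : C.Nonempty) (hcl : IsClosed C)
    (hconv : Convex ℝ C) {z₀ : X × ℝ} (hz₀ : 0 < z₀.2) :
    ∃ L : ℝ, 0 ≤ L ∧ ∀ᶠ z in 𝓝 z₀, ∀ V ∈ limitingJacobian C A b z, ‖V‖ ≤ L := by
  obtain ⟨L, hL0, hL⟩ := exists_eventually_norm_fderiv_le (A := A) (b := b) hne hcl hconv hz₀
  refine ⟨L, hL0, ?_⟩
  filter_upwards [hL.eventually_nhds] with z hz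
  rintro V ⟨s, hs, -, hV⟩
  exact le_of_tendsto (Tendsto.norm (E := X × ℝ →L[ℝ] X) hV) (hs.eventually hz)

lemma limitingJacobian_nonempty (hne : C.Nonempty) (hcl : IsClosed C)
    (hconv : Convex ℝ C) {z : X × ℝ} (hz : 0 < z.2) : (limitingJacobian C A b z).Nonempty := by
  obtain ⟨s, hs, hlim⟩ := mem_closure_iff_seq_limit.1
    (mem_closure_regularPoints (A := A) (b := b) hne hcl hconv hz)
  obtain ⟨L, -, hL⟩ := exists_eventually_norm_fderiv_le (A := A) (b := b) hne hcl hconv hz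
  have hmem : ∀ᶠ k in atTop, fderiv ℝ (projectionResidual C A b) (s k) ∈
      Metric.closedBall (0 : X × ℝ →L[ℝ] X) L := by
    filter_upwards [hlim.eventually hL] with k hk
    exact (mem_closedBall_zero_iff (E := X × ℝ →L[ℝ] X)).2 hk
  have : ProperSpace (X × ℝ →L[ℝ] X) := FiniteDimensional.proper ℝ (X × ℝ →L[ℝ] X)
  obtain ⟨V, -, φ, hφ, hV⟩ := (isCompact_closedBall (0 : X × ℝ →L[ℝ] X) L).tendsto_subseq'
    hmem.frequently
  exact ⟨V, s ∘ φ, hlim.comp hφ.tendsto_atTop, fun k => hs _, hV⟩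

/-- The estimate of strong semismoothness for the proximal residual. -/
lemma exists_eventually_estimate_limitingJacobian (hne : C.Nonempty) (hcl : IsClosed C)
    (hconv : Convex ℝ C) (hP : StronglySemismoothOn (metricProjection C) univ)
    {z₀ : X × ℝ} (hz₀ : 0 < z₀.2) :
    ∃ K : ℝ, 0 ≤ K ∧ ∀ᶠ z in 𝓝 z₀, ∀ V ∈ limitingJacobian C A b z,
      ‖projectionResidual C A b z - projectionResidual C A b z₀ - V (z - z₀)‖
        ≤ K * ‖z - z₀‖ ^ 2 := by
  have hw := contDiffAt_gradientStep (A := A) (b := b) hz₀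
  obtain ⟨c₁, hc₁, h₁⟩ := hw.exists_second_order_estimate
  obtain ⟨K, t, ht, hK⟩ := (hw.of_le (m := 1) (by norm_num)).exists_lipschitzOnWith
  obtain ⟨c₂, h₂⟩ := (hP (gradientStep A b z₀) (mem_univ _)).estimate
  have hsub : Tendsto (fun z => gradientStep A b z - gradientStep A b z₀) (𝓝 z₀) (𝓝 0) := by
    simpa using hw.continuousAt.tendsto.sub_const (gradientStep A b z₀)
  have hreg : ∀ᶠ z in 𝓝 z₀, z ∈ regularPoints C A b →
      ‖projectionResidual C A b z - projectionResidual C A b z₀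
        - fderiv ℝ (projectionResidual C A b) z (z - z₀)‖
        ≤ (2 * c₁ + |c₂| * K ^ 2) * ‖z - z₀‖ ^ 2 := by
    filter_upwards [h₁, ht, hsub.eventually h₂] with z hz₁ hzt hz₂ hz
    set S := fderiv ℝ (metricProjection C) (gradientStep A b z) with hS
    have hSmem : S ∈ clarkeJacobian (metricProjection C)
        (gradientStep A b z₀ + (gradientStep A b z - gradientStep A b z₀)) := by
      rw [add_sub_cancel]
      -- At a point of differentiability the derivative itself is a limit, along the constant
      -- sequence.
      exact subset_convexHull ℝ _ ⟨fun _ => gradientStep A b z, tendsto_const_nhds,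
        fun _ => hz.2, tendsto_const_nhds⟩
    have h3 := hz₂ S hSmem
    rw [add_sub_cancel] at h3
    have hlip := hK.dist_le_mul z hzt z₀ (mem_of_mem_nhds ht)
    rw [dist_eq_norm, dist_eq_norm] at hlip
    have hS1 : ‖S‖ ≤ 1 := by
      simpa using norm_fderiv_le_of_lipschitz ℝ (x₀ := gradientStep A b z)
        (lipschitzWith_metricProjection hne hcl hconv)
    rw [(hasFDerivAt_projectionResidual hz).fderiv]
    set W := fderiv ℝ (gradientStep A b) z
    set dw := gradientStep A b z - gradientStep A b z₀ with hdw
    -- The error splits into the semismooth error of the projection and the Taylor error of the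
    -- gradient step. The latter appears twice, once through S with ‖S‖ ≤ 1, hence the 2c₁.
    have e : projectionResidual C A b z - projectionResidual C A b z₀
        - (ContinuousLinearMap.fst ℝ X ℝ - W + S ∘L W) (z - z₀)
        = (metricProjection C (gradientStep A b z) - metricProjection C (gradientStep A b z₀)
            - S dw) + (S (dw - W (z - z₀)) - (dw - W (z - z₀))) := by
      change _ - _ - ((z - z₀).1 - W (z - z₀) + S (W (z - z₀))) = _
      simp only [projectionResidual, Prod.fst_sub, hdw, map_sub S]
      abel
    rw [e]
    have h4 : ‖S (dw - W (z - z₀))‖ ≤ c₁ * ‖z - z₀‖ ^ 2 := by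
      refine (S.le_of_opNorm_le hS1 _).trans ?_
      rw [one_mul]
      exact hz₁
    have h5 : c₂ * ‖dw‖ ^ 2 ≤ |c₂| * K ^ 2 * ‖z - z₀‖ ^ 2 := by
      rw [mul_assoc, ← mul_pow]
      gcongr
      exact le_abs_self _
    have h6 := norm_add_le (metricProjection C (gradientStep A b z)
      - metricProjection C (gradientStep A b z₀) - S dw)
      (S (dw - W (z - z₀)) - (dw - W (z - z₀)))
    have h7 := norm_sub_le (S (dw - W (z - z₀))) (dw - W (z - z₀))
    linarith
  refine ⟨2 * c₁ + |c₂| * K ^ 2, by positivity, ?_⟩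
  filter_upwards [hreg.eventually_nhds, eventually_pos_snd hz₀] with z hz hz0 V ⟨s, hs, hsr, hV⟩
  have hHs := (continuousAt_projectionResidual (A := A) (b := b) hne hcl hconv hz0).tendsto.comp hs
  have hss : Tendsto (fun k => s k - z₀) atTop (𝓝 (z - z₀)) := hs.sub_const z₀
  have hVs : Tendsto (fun k => fderiv ℝ (projectionResidual C A b) (s k) (s k - z₀)) atTop
      (𝓝 (V (z - z₀))) :=
    (isBoundedBilinearMap_apply.continuous.tendsto (V, z - z₀)).comp (hV.prodMk_nhds hss)
  refine le_of_tendsto_of_tendsto ((hHs.sub_const _).sub hVs).norm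
    ((hss.norm.pow 2).const_mul _) ?_
  filter_upwards [hs.eventually hz] with k hk using hk (hsr k)

/-- Nondegeneracy at a point gives a uniform lower bound nearby. -/
lemma exists_eventually_lower_bound_limitingJacobian (hne : C.Nonempty) (hcl : IsClosed C)
    (hconv : Convex ℝ C) {z₀ : X × ℝ} (hz₀ : 0 < z₀.2)
    (hnd : IsNondegenerate (partialClarkeJacobian (projectionResidual C A b) z₀)) :
    ∃ c : ℝ, 0 < c ∧ ∀ᶠ z in 𝓝 z₀, ∀ V ∈ limitingJacobian C A b z, ∀ d : X,
      c * ‖d‖ ≤ ‖V (d, 0)‖ := by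
  have hreg : ∃ c : ℝ, 0 < c ∧ ∀ᶠ z in 𝓝 z₀, z ∈ regularPoints C A b →
      ∀ d : X, c * ‖d‖ ≤ ‖fderiv ℝ (projectionResidual C A b) z (d, 0)‖ := by
    -- Otherwise regular points and unit directions subconverge, by compactness, to an element of
    -- the Clarke Jacobian that kills some (e, 0) with ‖e‖ = 1.
    by_contra! hcon
    have hex : ∀ k : ℕ, ∃ z d, dist z z₀ < 1 / ((k : ℝ) + 1) ∧ z ∈ regularPoints C A b ∧
        ‖d‖ = 1 ∧ ‖fderiv ℝ (projectionResidual C A b) z (d, 0)‖ ≤ 1 / ((k : ℝ) + 1) := by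
      intro k
      have hk : 0 < 1 / ((k : ℝ) + 1) := by positivity
      obtain ⟨z, ⟨hz, d, hd⟩, hzk⟩ := ((hcon _ hk).and_eventually
        (Metric.ball_mem_nhds z₀ hk)).exists
      have hd0 : d ≠ 0 := by
        rintro rfl
        rw [norm_zero, mul_zero] at hd
        exact absurd hd (not_lt.2 (norm_nonneg _))
      have hdn : 0 < ‖d‖ := norm_pos_iff.2 hd0
      refine ⟨z, ‖d‖⁻¹ • d, hzk, hz, ?_, ?_⟩
      · rw [norm_smul, norm_inv, norm_norm, inv_mul_cancel₀ hdn.ne']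
      · have : ((‖d‖⁻¹ • d, 0) : X × ℝ) = ‖d‖⁻¹ • (d, 0) := by simp
        rw [this, map_smul, norm_smul, norm_inv, norm_norm, inv_mul_le_iff₀ hdn, mul_comm]
        exact hd.le
    choose z d hzk hz hd hdk using hex
    have hlim0 : Tendsto (fun k : ℕ => 1 / ((k : ℝ) + 1)) atTop (𝓝 0) :=
      tendsto_one_div_add_atTop_nhds_zero_nat
    have hzlim : Tendsto z atTop (𝓝 z₀) := tendsto_iff_dist_tendsto_zero.2
      (squeeze_zero (fun _ => dist_nonneg) (fun k => (hzk k).le) hlim0)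
    obtain ⟨L, -, hL⟩ := exists_eventually_norm_fderiv_le (A := A) (b := b) hne hcl hconv hz₀
    have hmem : ∀ᶠ k in atTop, (fderiv ℝ (projectionResidual C A b) (z k), d k) ∈
        Metric.closedBall (0 : X × ℝ →L[ℝ] X) L ×ˢ Metric.sphere (0 : X) 1 := by
      filter_upwards [hzlim.eventually hL] with k hk
      exact ⟨(mem_closedBall_zero_iff (E := X × ℝ →L[ℝ] X)).2 hk, by simpa using hd k⟩
    have : ProperSpace (X × ℝ →L[ℝ] X) := FiniteDimensional.proper ℝ (X × ℝ →L[ℝ] X)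
    obtain ⟨⟨V, e⟩, ⟨-, he⟩, φ, hφ, hV⟩ := ((isCompact_closedBall (0 : X × ℝ →L[ℝ] X) L).prod
      (isCompact_sphere (0 : X) 1)).tendsto_subseq' hmem.frequently
    have hV1 : Tendsto (fun k => fderiv ℝ (projectionResidual C A b) (z (φ k))) atTop (𝓝 V) :=
      (continuous_fst.tendsto _).comp hV
    have hV2 : Tendsto (fun k => d (φ k)) atTop (𝓝 e) := (continuous_snd.tendsto _).comp hV
    have hV3 : Tendsto (fun k => fderiv ℝ (projectionResidual C A b) (z (φ k)) (d (φ k), 0)) atTop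
        (𝓝 (V (e, 0))) :=
      (isBoundedBilinearMap_apply.continuous.tendsto (V, ((e, 0) : X × ℝ))).comp
        (hV1.prodMk_nhds (hV2.prodMk_nhds tendsto_const_nhds))
    have hVe : V (e, 0) = 0 := by
      refine tendsto_nhds_unique hV3 (squeeze_zero_norm (fun k => hdk (φ k))
        (hlim0.comp hφ.tendsto_atTop))
    have hVmem : V ∈ clarkeJacobian (projectionResidual C A b) z₀ :=
      subset_convexHull ℝ _ ⟨z ∘ φ, hzlim.comp hφ.tendsto_atTop,
        fun k => (hasFDerivAt_projectionResidual (hz _)).differentiableAt, hV1⟩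
    have hbij := hnd _ ⟨V, hVmem, rfl⟩
    have : e = 0 := hbij.injective (by
      rw [_root_.map_zero]
      exact hVe)
    rw [this] at he
    simp at he
  obtain ⟨c, hc, hreg⟩ := hreg
  refine ⟨c, hc, ?_⟩
  filter_upwards [hreg.eventually_nhds] with z hz V ⟨s, hs, hsr, hV⟩ d
  have hVd : Tendsto (fun k => fderiv ℝ (projectionResidual C A b) (s k) (d, 0)) atTop
      (𝓝 (V (d, 0))) :=
    (ContinuousLinearMap.apply ℝ X ((d, 0) : X × ℝ)).continuous.continuousAt.tendsto.comp hV
  refine ge_of_tendsto hVd.norm ?_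
  filter_upwards [hs.eventually hz] with k hk using hk (hsr k) d

end LimitingJacobian

/-! ### Convexity of the penalized objective. -/

section ValueBounds

variable {X Y : Type*} [NormedAddCommGroup X] [InnerProductSpace ℝ X] [CompleteSpace X]
  [NormedAddCommGroup Y] [InnerProductSpace ℝ Y] [CompleteSpace Y]
  {C : Set X} {A : X →L[ℝ] Y} {b : Y} {x x₀ : X} {l l₀ : ℝ}

/-- The penalized objective at `x` is at most its value at the KKT point `(x₀, l₀)`. -/
def IsBelowKKTValue (C : Set X) (A : X →L[ℝ] Y) (b : Y) (x₀ : X) (l₀ : ℝ) (x : X) (l : ℝ) : Prop :=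
  ∀ c ∈ C, 1 / 2 * ‖A x - b‖ ^ 2 + l * inner ℝ c x
    ≤ 1 / 2 * ‖A x₀ - b‖ ^ 2 + l * inner ℝ (l₀⁻¹ • A.adjoint (b - A x₀)) x₀

/-- KKT points are global minimizers: the multiplier of `x` attains the support function at `x` and
bounds it from below at `x₀`. -/
lemma IsKKTPoint.isBelowKKTValue (hl : 0 < l) (h : IsKKTPoint C A b x l)
    (h₀ : IsKKTPoint C A b x₀ l₀) : IsBelowKKTValue C A b x₀ l₀ x l := by
  intro c hc
  have h1 := mul_le_mul_of_nonneg_left (h.le c hc) hl.le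
  have h2 := mul_le_mul_of_nonneg_left (h₀.le _ h.mem) hl.le
  have h3 : ∀ a : X, l * inner ℝ (l⁻¹ • A.adjoint (b - A x)) a = - inner ℝ (A x - b) (A a) := by
    intro a
    rw [real_inner_smul_left, ContinuousLinearMap.adjoint_inner_left, ← mul_assoc,
      mul_inv_cancel₀ hl.ne', one_mul, ← neg_sub, inner_neg_left]
  rw [h3] at h1 h2
  have h4 : A x₀ - b = (A x - b) + (A x₀ - A x) := by abel
  have h5 : ‖A x₀ - b‖ ^ 2 = ‖A x - b‖ ^ 2 + 2 * inner ℝ (A x - b) (A x₀ - A x)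
      + ‖A x₀ - A x‖ ^ 2 := by
    rw [h4, norm_add_sq_real]
  rw [inner_sub_right] at h5
  nlinarith [sq_nonneg ‖A x₀ - A x‖]

lemma IsBelowKKTValue.segment (hl : 0 < l) (h₀ : IsKKTPoint C A b x₀ l₀)
    (h : IsBelowKKTValue C A b x₀ l₀ x l) {s : ℝ} (hs : s ∈ Icc (0 : ℝ) 1) :
    IsBelowKKTValue C A b x₀ l₀ (x₀ + s • (x - x₀)) l := by
  intro c hc
  have h1 := h c hc
  have h2 := mul_le_mul_of_nonneg_left (h₀.le c hc) hl.le
  have h3 : A (x₀ + s • (x - x₀)) - b = (A x₀ - b) + s • (A x - A x₀) := by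
    rw [map_add, map_smul, map_sub]
    abel
  have h4 : A x - b = (A x₀ - b) + (A x - A x₀) := by abel
  have h5 : ‖A x - b‖ ^ 2 = ‖A x₀ - b‖ ^ 2 + 2 * inner ℝ (A x₀ - b) (A x - A x₀)
      + ‖A x - A x₀‖ ^ 2 := by rw [h4, norm_add_sq_real]
  have h6 : ‖A (x₀ + s • (x - x₀)) - b‖ ^ 2 = ‖A x₀ - b‖ ^ 2
      + 2 * (s * inner ℝ (A x₀ - b) (A x - A x₀)) + s ^ 2 * ‖A x - A x₀‖ ^ 2 := by
    rw [h3, norm_add_sq_real, real_inner_smul_right, norm_smul, mul_pow, Real.norm_eq_abs, sq_abs]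
  have h7 : inner ℝ c (x₀ + s • (x - x₀)) = inner ℝ c x₀ + s * (inner ℝ c x - inner ℝ c x₀) := by
    rw [inner_add_right, real_inner_smul_right, inner_sub_right]
  rw [h6, h7]
  have h8 := mul_le_mul_of_nonneg_left h1 hs.1
  have h9 := mul_le_mul_of_nonneg_left h2 (sub_nonneg.2 hs.2)
  have h10 : s ^ 2 * ‖A x - A x₀‖ ^ 2 ≤ s * ‖A x - A x₀‖ ^ 2 :=
    mul_le_mul_of_nonneg_right (by nlinarith [hs.1, hs.2]) (sq_nonneg _)
  rw [h5] at h8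
  linarith

/-- Testing with the multiplier of `x₀` forces A x = A x₀, by strict convexity in A x. Both points
then share that multiplier, and the remaining inequalities say that it exposes `x`. -/
lemma IsBelowKKTValue.isKKTPoint (hl₀ : 0 < l₀) (h₀ : IsKKTPoint C A b x₀ l₀)
    (h : IsBelowKKTValue C A b x₀ l₀ x l₀) : IsKKTPoint C A b x l₀ := by
  have h3 : ∀ a : X, l₀ * inner ℝ (l₀⁻¹ • A.adjoint (b - A x₀)) a
      = - inner ℝ (A x₀ - b) (A a) := by
    intro a
    rw [real_inner_smul_left, ContinuousLinearMap.adjoint_inner_left, ← mul_assoc,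
      mul_inv_cancel₀ hl₀.ne', one_mul, ← neg_sub, inner_neg_left]
  have h4 : A x - b = (A x₀ - b) + (A x - A x₀) := by abel
  have h5 : ‖A x - b‖ ^ 2 = ‖A x₀ - b‖ ^ 2 + 2 * inner ℝ (A x₀ - b) (A x - A x₀)
      + ‖A x - A x₀‖ ^ 2 := by rw [h4, norm_add_sq_real]
  have h1 := h _ h₀.mem
  rw [inner_sub_right] at h5
  rw [h3, h3] at h1
  have hA : A x = A x₀ := by
    have : ‖A x - A x₀‖ ^ 2 ≤ 0 := by linarith
    exact sub_eq_zero.1 (norm_eq_zero.1 (pow_eq_zero_iff two_ne_zero |>.1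
      (le_antisymm this (sq_nonneg _))))
  refine ⟨by rw [hA]; exact h₀.mem, fun c hc => ?_⟩
  have h6 := h c hc
  rw [h3, hA] at h6
  rw [hA]
  refine le_of_mul_le_mul_left ?_ hl₀
  rw [h3, hA]
  linarith

end ValueBounds

/-! ### Calmness and Lipschitz quotients of the solution path. -/

section SolutionPath

variable {X Y : Type*} [NormedAddCommGroup X] [InnerProductSpace ℝ X] [FiniteDimensional ℝ X]
  [NormedAddCommGroup Y] [InnerProductSpace ℝ Y] [FiniteDimensional ℝ Y]
  {C : Set X} {A : X →L[ℝ] Y} {b : Y} {x₀ : X} {l₀ : ℝ}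

/-- Nearby KKT points vary calmly with the parameter. -/
lemma exists_eventually_calm_isKKTPoint (hne : C.Nonempty) (hcl : IsClosed C) (hconv : Convex ℝ C)
    (hP : StronglySemismoothOn (metricProjection C) univ) (hl₀ : 0 < l₀)
    (h₀ : IsKKTPoint C A b x₀ l₀) {c : ℝ} (hc : 0 < c)
    (hnd : ∀ᶠ z in 𝓝 (x₀, l₀), ∀ V ∈ limitingJacobian C A b z, ∀ d : X, c * ‖d‖ ≤ ‖V (d, 0)‖) :
    ∃ K : ℝ, 0 ≤ K ∧ ∀ᶠ z in 𝓝 (x₀, l₀), IsKKTPoint C A b z.1 z.2 →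
      ‖z.1 - x₀‖ ≤ K * |z.2 - l₀| := by
  have hz₀ : 0 < ((x₀, l₀) : X × ℝ).2 := hl₀
  obtain ⟨K, hK0, hK⟩ :=
    exists_eventually_estimate_limitingJacobian (A := A) (b := b) hne hcl hconv hP hz₀
  obtain ⟨L, hL0, hL⟩ :=
    exists_eventually_norm_le_of_mem_limitingJacobian (A := A) (b := b) hne hcl hconv hz₀
  -- Lets the quadratic error be absorbed into half of the lower bound c‖x - x₀‖.
  have hsmall : ∀ᶠ z in 𝓝 (x₀, l₀), K * ‖z - (x₀, l₀)‖ ≤ c / 2 := by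
    have hcont : Continuous fun z : X × ℝ => K * ‖z - (x₀, l₀)‖ := by fun_prop
    have := hcont.tendsto (x₀, l₀)
    simp only [sub_self, norm_zero, mul_zero] at this
    exact (this.eventually_lt_const (half_pos hc)).mono fun _ h => h.le
  refine ⟨1 + 2 * L / c, by positivity, ?_⟩
  filter_upwards [hnd, hK, hL, hsmall, eventually_pos_snd hz₀] with z h1 h2 h3 h4 hz hzK
  obtain ⟨V, hV⟩ := limitingJacobian_nonempty (A := A) (b := b) hne hcl hconv hz
  have e0 : projectionResidual C A b (x₀, l₀) = 0 :=
    (projectionResidual_eq_zero_iff hne hcl hconv).2 h₀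
  have e1 : projectionResidual C A b z = 0 :=
    (projectionResidual_eq_zero_iff hne hcl hconv).2 hzK
  have h5 := h2 V hV
  rw [e0, e1, sub_self, zero_sub, norm_neg] at h5
  have h6 := h1 V hV (z.1 - x₀)
  have e2 : ((z.1 - x₀, 0) : X × ℝ) = (z - (x₀, l₀)) - (0, z.2 - l₀) := by
    ext <;> simp
  have h7 : ‖V (0, z.2 - l₀)‖ ≤ L * |z.2 - l₀| := by
    refine (V.le_of_opNorm_le (h3 V hV) _).trans (le_of_eq ?_)
    simp [Prod.norm_def]
  rw [e2, map_sub] at h6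
  have h8 := norm_sub_le (V (z - (x₀, l₀))) (V (0, z.2 - l₀))
  have h9 : ‖z - (x₀, l₀)‖ ≤ ‖z.1 - x₀‖ + |z.2 - l₀| := by
    rw [Prod.norm_def]
    exact max_le (le_add_of_nonneg_right (abs_nonneg _)) (le_add_of_nonneg_left (norm_nonneg _))
  have h10 : K * ‖z - (x₀, l₀)‖ ^ 2 ≤ c / 2 * (‖z.1 - x₀‖ + |z.2 - l₀|) := by
    rw [pow_two, ← mul_assoc]
    exact mul_le_mul h4 h9 (norm_nonneg _) (by positivity)
  have h11 : c / 2 * ‖z.1 - x₀‖ ≤ c / 2 * ((1 + 2 * L / c) * |z.2 - l₀|) := by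
    have : c / 2 * ((1 + 2 * L / c) * |z.2 - l₀|) = c / 2 * |z.2 - l₀| + L * |z.2 - l₀| := by
      field_simp
    rw [this]
    linarith
  exact le_of_mul_le_mul_left h11 (half_pos hc)

/-- If a KKT point is isolated then the KKT points for nearby parameters are close to it. -/
lemma eventually_norm_sub_lt_of_isKKTPoint (hl₀ : 0 < l₀) (h₀ : IsKKTPoint C A b x₀ l₀)
    (hiso : ∀ᶠ x in 𝓝 x₀, IsKKTPoint C A b x l₀ → x = x₀) {ε : ℝ} (hε : 0 < ε) :
    ∀ᶠ l in 𝓝 l₀, ∀ x, IsKKTPoint C A b x l → ‖x - x₀‖ < ε := by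
  obtain ⟨r, hr, hball⟩ := Metric.eventually_nhds_iff.1 hiso
  -- The sphere of radius η lies inside the isolation ball. Far solutions are pulled back to it
  -- along segments to `x₀`, and a limit point there would be a second KKT point at `l₀`.
  set η := min ε (r / 2) with hη
  have hη0 : 0 < η := lt_min hε (half_pos hr)
  by_contra hcon
  rw [not_eventually] at hcon
  obtain ⟨l, hl, hx⟩ := exists_seq_forall_of_frequently
    (hcon.and_eventually (eventually_gt_nhds hl₀))
  simp only [not_forall, not_lt] at hx
  choose x hxK hxε using fun k => (hx k).1
  have hl0 : ∀ k, 0 < l k := fun k => (hx k).2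
  have hxη : ∀ k, η ≤ ‖x k - x₀‖ := fun k => (min_le_left _ _).trans (hxε k)
  have hpos : ∀ k, 0 < ‖x k - x₀‖ := fun k => hη0.trans_le (hxη k)
  set w : ℕ → X := fun k => x₀ + (η / ‖x k - x₀‖) • (x k - x₀) with hw
  have hwmem : ∀ k, w k ∈ Metric.sphere x₀ η := fun k => by
    rw [mem_sphere_iff_norm, hw]
    simp only [add_sub_cancel_left]
    rw [norm_smul, Real.norm_eq_abs, abs_of_pos (div_pos hη0 (hpos k)),
      div_mul_cancel₀ _ (hpos k).ne']
  have hwQ : ∀ k, IsBelowKKTValue C A b x₀ l₀ (w k) (l k) := fun k =>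
    ((hxK k).isBelowKKTValue (hl0 k) h₀).segment (hl0 k) h₀
      ⟨(div_pos hη0 (hpos k)).le, (div_le_one (hpos k)).2 (hxη k)⟩
  obtain ⟨v, hv, φ, hφ, hlim⟩ := (isCompact_sphere x₀ η).tendsto_subseq hwmem
  have hllim := hl.comp hφ.tendsto_atTop
  have hvQ : IsBelowKKTValue C A b x₀ l₀ v l₀ := by
    intro c hc
    have c1 : Continuous fun a : X × ℝ => 1 / 2 * ‖A a.1 - b‖ ^ 2 + a.2 * inner ℝ c a.1 := by
      fun_prop
    have c2 : Continuous fun a : X × ℝ =>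
        1 / 2 * ‖A x₀ - b‖ ^ 2 + a.2 * inner ℝ (l₀⁻¹ • A.adjoint (b - A x₀)) x₀ := by
      fun_prop
    have hp := hlim.prodMk_nhds hllim
    exact le_of_tendsto_of_tendsto' ((c1.tendsto (v, l₀)).comp hp) ((c2.tendsto (v, l₀)).comp hp)
      fun k => hwQ _ c hc
  have hvη : ‖v - x₀‖ = η := mem_sphere_iff_norm.1 hv
  have hvx : v = x₀ := by
    refine hball ?_ (hvQ.isKKTPoint hl₀ h₀)
    rw [dist_eq_norm, hvη]
    exact (min_le_right _ _).trans_lt (half_lt_self hr)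
  rw [hvx, sub_self, norm_zero] at hvη
  exact hη0.ne hvη

/-- A selection of KKT points is calm at a nondegenerate KKT point. -/
lemma exists_eventually_calm_path (hne : C.Nonempty) (hcl : IsClosed C) (hconv : Convex ℝ C)
    (hP : StronglySemismoothOn (metricProjection C) univ) (hl₀ : 0 < l₀)
    (h₀ : IsKKTPoint C A b x₀ l₀) {c : ℝ} (hc : 0 < c)
    (hnd : ∀ᶠ z in 𝓝 (x₀, l₀), ∀ V ∈ limitingJacobian C A b z, ∀ d : X, c * ‖d‖ ≤ ‖V (d, 0)‖)
    {x : ℝ → X} (hx : ∀ l : ℝ, 0 < l → IsKKTPoint C A b (x l) l) :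
    ∃ K : ℝ, 0 ≤ K ∧ ∀ᶠ l in 𝓝 l₀, ‖x l - x₀‖ ≤ K * |l - l₀| := by
  obtain ⟨K, hK0, hK⟩ := exists_eventually_calm_isKKTPoint hne hcl hconv hP hl₀ h₀ hc hnd
  -- Calmness at the unchanged parameter is isolation.
  have hiso : ∀ᶠ x in 𝓝 x₀, IsKKTPoint C A b x l₀ → x = x₀ := by
    have hcont : Continuous fun x : X => (x, l₀) := by fun_prop
    filter_upwards [(hcont.tendsto x₀).eventually hK] with x hxK h
    have := hxK h
    simp only [sub_self, abs_zero, mul_zero] at this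
    exact sub_eq_zero.1 (norm_le_zero_iff.1 this)
  refine ⟨K, hK0, ?_⟩
  obtain ⟨ε, hε, hball⟩ := Metric.eventually_nhds_iff.1 hK
  filter_upwards [eventually_norm_sub_lt_of_isKKTPoint hl₀ h₀ hiso hε, Metric.ball_mem_nhds l₀ hε,
    eventually_gt_nhds hl₀] with l h1 h2 h3
  refine hball (y := (x l, l)) ?_ (hx l h3)
  rw [Prod.dist_eq]
  exact max_lt (by rw [dist_eq_norm]; exact h1 _ (hx l h3)) h2

lemma norm_prod_sub_le_of_calm {X : Type*} [NormedAddCommGroup X] {x₀ x : X} {l₀ l K : ℝ} (hK : 0 ≤ K) (h : ‖x - x₀‖ ≤ K * |l - l₀|) :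
    ‖((x, l) : X × ℝ) - (x₀, l₀)‖ ≤ (K + 1) * |l - l₀| := by
  rw [Prod.norm_def, add_mul, one_mul]
  exact max_le (h.trans (le_add_of_nonneg_right (abs_nonneg _)))
    (le_add_of_nonneg_left (mul_nonneg hK (abs_nonneg _)))

/-- The solution path has Lipschitz difference quotients at a nondegenerate KKT point. -/
lemma hasLipschitzSlopeAt_path (hne : C.Nonempty) (hcl : IsClosed C) (hconv : Convex ℝ C)
    (hP : StronglySemismoothOn (metricProjection C) univ) (hl₀ : 0 < l₀)
    (h₀ : IsKKTPoint C A b x₀ l₀)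
    (hnd : IsNondegenerate (partialClarkeJacobian (projectionResidual C A b) (x₀, l₀)))
    {x : ℝ → X} (hx : ∀ l : ℝ, 0 < l → IsKKTPoint C A b (x l) l) :
    HasLipschitzSlopeAt x l₀ := by
  have hz₀ : 0 < ((x₀, l₀) : X × ℝ).2 := hl₀
  obtain ⟨c, hc, hlow⟩ := exists_eventually_lower_bound_limitingJacobian hne hcl hconv hz₀ hnd
  obtain ⟨K, hK0, hK⟩ := exists_eventually_calm_path hne hcl hconv hP hl₀ h₀ hc hlow hx
  have hx₀ : x l₀ = x₀ := by
    have := hK.self_of_nhds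
    rw [sub_self, abs_zero, mul_zero] at this
    exact sub_eq_zero.1 (norm_le_zero_iff.1 this)
  obtain ⟨M, hM0, hM⟩ :=
    exists_eventually_estimate_limitingJacobian (A := A) (b := b) hne hcl hconv hP hz₀
  have hpath : Tendsto (fun l => (x l, l)) (𝓝 l₀) (𝓝 (x₀, l₀)) := by
    refine Tendsto.prodMk_nhds ?_ tendsto_id
    rw [tendsto_iff_norm_sub_tendsto_zero]
    have hcont : Continuous fun l : ℝ => K * |l - l₀| := by fun_prop
    have := hcont.tendsto l₀
    simp only [sub_self, abs_zero, mul_zero] at this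
    exact squeeze_zero' (Eventually.of_forall fun _ => norm_nonneg _) hK this
  obtain ⟨δ, hδ, hall⟩ := Metric.eventually_nhds_iff.1 ((hpath.eventually
    (hlow.and hM).eventually_nhds).and (hK.eventually_nhds.and (eventually_gt_nhds hl₀)))
  have hM' : 0 ≤ (4 * (M * (K + 1) ^ 2) + 1) / c := by positivity
  refine hasLipschitzSlopeAt_of_eventually (δ := δ) hδ (C := ⟨_, hM'⟩) fun s hs0 hs => ?_
  obtain ⟨hnear, hKs, hls⟩ := hall (y := l₀ + s) (by simpa using hs)
  have hxs := hx _ hls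
  -- The lower bound `c` persists nearby, so calmness can be restarted at the shifted base point.
  -- The constants `K'` and `M'` depend on s.
  obtain ⟨K', hK'0, hK'⟩ := exists_eventually_calm_path hne hcl hconv hP hls hxs hc
    (hnear.mono fun _ h => h.1) hx
  have hzs : 0 < ((x (l₀ + s), l₀ + s) : X × ℝ).2 := hls
  obtain ⟨M', hM'0, hMs⟩ :=
    exists_eventually_estimate_limitingJacobian (A := A) (b := b) hne hcl hconv hP hzs
  have hpath' : Tendsto (fun l => (x l, l)) (𝓝 (l₀ + s)) (𝓝 (x (l₀ + s), l₀ + s)) := by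
    refine Tendsto.prodMk_nhds ?_ tendsto_id
    rw [tendsto_iff_norm_sub_tendsto_zero]
    have hcont : Continuous fun l : ℝ => K' * |l - (l₀ + s)| := by fun_prop
    have := hcont.tendsto (l₀ + s)
    simp only [sub_self, abs_zero, mul_zero] at this
    exact squeeze_zero' (Eventually.of_forall fun _ => norm_nonneg _) hK' this
  have hshift : Tendsto (fun t : ℝ => l₀ + t) (𝓝 s) (𝓝 (l₀ + s)) := by
    have : Continuous fun t : ℝ => l₀ + t := by fun_prop
    exact this.tendsto s
  -- The s-dependent constants disappear as t → s, leaving only the summand 1 in the final constant;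
  -- its other summand 4M(K+1)² comes from |t| < 2|s|.
  have hsmall : ∀ᶠ t in 𝓝 s, |t| * (M' * (K' + 1) ^ 2 * |t - s|) < s ^ 2 := by
    have hcont : Continuous fun t : ℝ => |t| * (M' * (K' + 1) ^ 2 * |t - s|) := by fun_prop
    have := hcont.tendsto s
    simp only [sub_self, abs_zero, mul_zero] at this
    exact this.eventually_lt_const (by positivity)
  have hts : ∀ᶠ t in 𝓝 s, |t| < 2 * |s| :=
    (continuous_abs.tendsto s).eventually_lt_const (by linarith [abs_pos.2 hs0])
  filter_upwards [hshift.eventually hKs, hshift.eventually hK', hsmall, hts,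
    hshift.eventually (hpath'.eventually hnear), hshift.eventually (hpath'.eventually hMs),
    hshift.eventually (eventually_gt_nhds hls)] with t a1 a2 a3 a4 a5 a6 a7
  obtain ⟨V, hV⟩ := limitingJacobian_nonempty (A := A) (b := b) hne hcl hconv
    (z := (x (l₀ + t), l₀ + t)) a7
  have hzero : ∀ {a : X} {r : ℝ}, IsKKTPoint C A b a r → projectionResidual C A b (a, r) = 0 :=
    fun h => (projectionResidual_eq_zero_iff hne hcl hconv).2 h
  have b1 := a5.2 V hV
  have b2 := a6 V hV
  rw [hzero (hx _ a7), hzero h₀, sub_self, zero_sub, norm_neg] at b1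
  rw [hzero (hx _ a7), hzero hxs, sub_self, zero_sub, norm_neg] at b2
  have d1 := norm_prod_sub_le_of_calm hK0 a1
  have d2 := norm_prod_sub_le_of_calm hK'0 a2
  rw [add_sub_cancel_left] at d1
  rw [add_sub_add_left_eq_sub] at d2
  set z := (x (l₀ + t), l₀ + t) with hz
  have e : ((s • (x (l₀ + t) - x l₀) - t • (x (l₀ + s) - x l₀), 0) : X × ℝ)
      = t • (z - (x (l₀ + s), l₀ + s)) - (t - s) • (z - (x₀, l₀)) := by
    rw [hx₀]
    refine Prod.ext ?_ ?_
    · simp only [hz, Prod.fst_sub, Prod.smul_fst]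
      module
    · simp only [hz, Prod.snd_sub, Prod.smul_snd, smul_eq_mul]
      ring
  have b3 := a5.1 V hV (s • (x (l₀ + t) - x l₀) - t • (x (l₀ + s) - x l₀))
  rw [e, map_sub, map_smul, map_smul] at b3
  have b4 := norm_sub_le (t • V (z - (x (l₀ + s), l₀ + s))) ((t - s) • V (z - (x₀, l₀)))
  rw [norm_smul, norm_smul, Real.norm_eq_abs, Real.norm_eq_abs] at b4
  have b5 : |t| * ‖V (z - (x (l₀ + s), l₀ + s))‖ ≤ s ^ 2 * |t - s| := by
    have : ‖V (z - (x (l₀ + s), l₀ + s))‖ ≤ M' * ((K' + 1) * |t - s|) ^ 2 :=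
      b2.trans (by gcongr)
    calc |t| * ‖V (z - (x (l₀ + s), l₀ + s))‖ ≤ |t| * (M' * ((K' + 1) * |t - s|) ^ 2) := by gcongr
      _ = |t| * (M' * (K' + 1) ^ 2 * |t - s|) * |t - s| := by ring
      _ ≤ _ := by gcongr
  have b6 : |t - s| * ‖V (z - (x₀, l₀))‖ ≤ 4 * (M * (K + 1) ^ 2) * s ^ 2 * |t - s| := by
    have : ‖V (z - (x₀, l₀))‖ ≤ M * ((K + 1) * (2 * |s|)) ^ 2 :=
      b1.trans (by gcongr; exact d1.trans (by gcongr))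
    calc |t - s| * ‖V (z - (x₀, l₀))‖ ≤ |t - s| * (M * ((K + 1) * (2 * |s|)) ^ 2) := by gcongr
      _ = 4 * (M * (K + 1) ^ 2) * |s| ^ 2 * |t - s| := by ring
      _ = _ := by rw [sq_abs]
  change _ ≤ (4 * (M * (K + 1) ^ 2) + 1) / c * s ^ 2 * |t - s|
  rw [div_mul_eq_mul_div, div_mul_eq_mul_div, le_div_iff₀ hc, mul_comm]
  linarith

end SolutionPath

/-! ### Parametric quadratic programs over polyhedra. -/

section Polyhedral

variable {X Y : Type*} [NormedAddCommGroup X] [InnerProductSpace ℝ X]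
  [NormedAddCommGroup Y] [InnerProductSpace ℝ Y] {A : X →L[ℝ] Y} {b : Y}

/-- The indices of the constraints which are active at a point. -/
def activeSet {V : Type*} [AddCommGroup V] [Module ℝ V] {k : ℕ} (f : Fin k → V →ₗ[ℝ] ℝ)
    (d : Fin k → ℝ) (z : V) : Set (Fin k) := {i | f i z = d i}

/-- The objective is stationary along the directions which preserve the active constraints. -/
lemma inner_add_eq_zero_of_activeSet {k : ℕ} {f : Fin k → X × ℝ →ₗ[ℝ] ℝ} {d : Fin k → ℝ}
    {x : X} {s l : ℝ} (hx : ∀ i, f i (x, s) ≤ d i)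
    (hmin : ∀ z, (∀ i, f i z ≤ d i) →
      1 / 2 * ‖A x - b‖ ^ 2 + l * s ≤ 1 / 2 * ‖A z.1 - b‖ ^ 2 + l * z.2)
    {v : X × ℝ} (hv : ∀ i ∈ activeSet f d (x, s), f i v = 0) :
    inner ℝ (A x - b) (A v.1) + l * v.2 = 0 := by
  have key : ∀ v : X × ℝ, (∀ i ∈ activeSet f d (x, s), f i v = 0) →
      0 ≤ inner ℝ (A x - b) (A v.1) + l * v.2 := by
    intro v hv
    have hev : ∀ᶠ τ in 𝓝[>] (0 : ℝ), ∀ i, f i ((x, s) + τ • v) ≤ d i := by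
      refine eventually_all.2 fun i => ?_
      simp only [map_add, map_smul, smul_eq_mul]
      rcases (hx i).lt_or_eq with hlt | heq
      · have hcont : Continuous fun τ : ℝ => f i (x, s) + τ * f i v := by fun_prop
        have := (hcont.tendsto 0).mono_left (nhdsWithin_le_nhds (s := Ioi 0))
        rw [zero_mul, add_zero] at this
        exact (this.eventually_lt_const hlt).mono fun _ h => h.le
      · refine Eventually.of_forall fun τ => ?_
        rw [hv i heq, mul_zero, add_zero, heq]
    obtain ⟨δ, hδ, hsub⟩ := mem_nhdsGT_iff_exists_Ioo_subset.1 hev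
    exact inner_add_nonneg_of_feasible_direction (S := {z | ∀ i, f i z ≤ d i}) hmin hδ
      fun τ hτ => hsub hτ
  refine le_antisymm ?_ (key v hv)
  have := key (-v) fun i hi => by rw [map_neg, hv i hi, neg_zero]
  simp only [Prod.fst_neg, Prod.snd_neg, map_neg, inner_neg_right] at this
  linarith

/-- On parameters with the same active set, the residual is affine. -/
lemma image_eq_lineMap_of_activeSet_eq {k : ℕ} {f : Fin k → X × ℝ →ₗ[ℝ] ℝ} {d : Fin k → ℝ}
    {x : ℝ → X} {s : ℝ → ℝ} (hx : ∀ l, 0 < l → ∀ i, f i (x l, s l) ≤ d i)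
    (hmin : ∀ l, 0 < l → ∀ z, (∀ i, f i z ≤ d i) →
      1 / 2 * ‖A (x l) - b‖ ^ 2 + l * s l ≤ 1 / 2 * ‖A z.1 - b‖ ^ 2 + l * z.2)
    {l₁ l₂ l : ℝ} (hl₁ : 0 < l₁) (hl₂ : 0 < l₂) (hl : 0 < l) (hne : l₁ ≠ l₂)
    (h₁ : activeSet f d (x l₁, s l₁) = activeSet f d (x l, s l))
    (h₂ : activeSet f d (x l₂, s l₂) = activeSet f d (x l, s l)) :
    A (x l) = A (x l₁) + ((l - l₁) / (l₂ - l₁)) • (A (x l₂) - A (x l₁)) := by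
  set θ := (l - l₁) / (l₂ - l₁) with hθ
  have hlθ : l = l₁ + θ * (l₂ - l₁) := by
    rw [hθ, div_mul_cancel₀ _ (sub_ne_zero.2 hne.symm)]
    ring
  -- The gap between the interpolated and the actual solution preserves the common active
  -- constraints, so the objective is stationary along it at all three parameters.
  set v : X × ℝ := (x l₁, s l₁) + θ • ((x l₂, s l₂) - (x l₁, s l₁)) - (x l, s l) with hv
  have hv0 : ∀ i ∈ activeSet f d (x l, s l), f i v = 0 := by
    intro i hi
    have e1 : f i (x l₁, s l₁) = d i := by rw [← h₁] at hi; exact hi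
    have e2 : f i (x l₂, s l₂) = d i := by rw [← h₂] at hi; exact hi
    have e3 : f i (x l, s l) = d i := hi
    rw [hv, map_sub, map_add, map_smul, map_sub, e1, e2, e3]
    simp
  have g := inner_add_eq_zero_of_activeSet (hx l hl) (hmin l hl) hv0
  have g₁ := inner_add_eq_zero_of_activeSet (hx l₁ hl₁) (hmin l₁ hl₁) (h₁ ▸ hv0)
  have g₂ := inner_add_eq_zero_of_activeSet (hx l₂ hl₂) (hmin l₂ hl₂) (h₂ ▸ hv0)
  have hAv : A v.1 = A (x l₁) + θ • (A (x l₂) - A (x l₁)) - A (x l) := by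
    simp only [hv, Prod.fst_sub, Prod.fst_add, Prod.smul_fst, map_sub, map_add, map_smul]
  have hzero : inner ℝ (A v.1) (A v.1) = 0 := by
    nth_rewrite 1 [hAv]
    simp only [inner_sub_left, inner_add_left, real_inner_smul_left] at g g₁ g₂ ⊢
    -- Interpolating the three stationarity equations cancels the terms in `v.2` and leaves ‖A v.1‖²
    -- = 0.
    linear_combination (1 - θ) * g₁ + θ * g₂ - g + v.2 * hlθ
  rw [inner_self_eq_zero, hAv, sub_eq_zero] at hzero
  exact hzero.symm

/-- The residual of a parametric quadratic program over a polyhedral set is piecewise affine. -/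
lemma isPiecewiseAffineOn_residual {S : Set (X × ℝ)} (hS : IsPolyhedralSet S)
    {x : ℝ → X} {s : ℝ → ℝ} (hx : ∀ l, 0 < l → (x l, s l) ∈ S)
    (hmin : ∀ l, 0 < l → ∀ z ∈ S,
      1 / 2 * ‖A (x l) - b‖ ^ 2 + l * s l ≤ 1 / 2 * ‖A z.1 - b‖ ^ 2 + l * z.2)
    {y : ℝ → Y} (hy : ∀ l, 0 < l → y l = b - A (x l)) (hcont : ContinuousOn y (Ioi 0)) :
    IsPiecewiseAffineOn y (Ioi 0) := by
  classical
  obtain ⟨k, f, d, rfl⟩ := hS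
  refine ⟨hcont, ?_⟩
  set J : ℝ → Set (Fin k) := fun l => activeSet f d (x l, s l) with hJ
  have hG : ∀ I : Set (Fin k), ∃ G : ℝ →ᵃ[ℝ] Y, ∀ l, 0 < l → J l = I → y l = G l := by
    intro I
    by_cases h : ∃ l₁ l₂ : ℝ, 0 < l₁ ∧ 0 < l₂ ∧ l₁ ≠ l₂ ∧ J l₁ = I ∧ J l₂ = I
    · obtain ⟨l₁, l₂, hl₁, hl₂, hne, h₁, h₂⟩ := h
      refine ⟨(AffineMap.lineMap (y l₁) (y l₂)).comp
        ((l₂ - l₁)⁻¹ • (AffineMap.id ℝ ℝ - AffineMap.const ℝ ℝ l₁)), fun l hl hI => ?_⟩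
      have := image_eq_lineMap_of_activeSet_eq hx hmin hl₁ hl₂ hl hne (h₁.trans hI.symm)
        (h₂.trans hI.symm)
      have e : ((l₂ - l₁)⁻¹ • (AffineMap.id ℝ ℝ - AffineMap.const ℝ ℝ l₁)) l
          = (l - l₁) / (l₂ - l₁) := by
        rw [div_eq_inv_mul]
        rfl
      rw [AffineMap.comp_apply, e, AffineMap.lineMap_apply_module', hy l hl, hy l₁ hl₁, hy l₂ hl₂,
        this]
      module
    -- Here at most one parameter has active set `I`, so a constant piece suffices.
    · by_cases h' : ∃ l₁ : ℝ, 0 < l₁ ∧ J l₁ = I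
      · obtain ⟨l₁, hl₁, h₁⟩ := h'
        refine ⟨AffineMap.const ℝ ℝ (y l₁), fun l hl hI => ?_⟩
        rcases eq_or_ne l l₁ with rfl | hne
        · simp
        · exact absurd ⟨l, l₁, hl, hl₁, hne, hI, h₁⟩ h
      · exact ⟨AffineMap.const ℝ ℝ 0, fun l hl hI => absurd ⟨l, hl, hI⟩ h'⟩
  choose G hG using hG
  refine ⟨Fintype.card (Set (Fin k)), fun j => G ((Fintype.equivFin (Set (Fin k))).symm j),
    fun l hl => ⟨Fintype.equivFin (Set (Fin k)) (J l), ?_⟩⟩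
  simp only [Equiv.symm_apply_apply]
  exact hG _ l hl rfl

end Polyhedral

end

/-! ### The main theorem. -/

theorem proposition3p5 {m n : ℕ}
    (p : EuclideanSpace ℝ (Fin n) → EReal)
    (hp : IsGaugeFunction p) (hp_closed : LowerSemicontinuous p)
    (A : Matrix (Fin m) (Fin n) ℝ) (b : EuclideanSpace ℝ (Fin m))
    (x : ℝ → EuclideanSpace ℝ (Fin n))
    (hx : ∀ l : ℝ, 0 < l → x l ∈ primalSolutions p A b l)
    (y : ℝ → EuclideanSpace ℝ (Fin m)) (u : ℝ → EuclideanSpace ℝ (Fin n))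
    (hyu : ∀ l : ℝ, 0 < l → IsDualSolution p A b l (y l) (u l))
    (φ : ℝ → ℝ) (hφ : ∀ l : ℝ, 0 < l → φ l = ‖Matrix.toEuclideanLin A (x l) - b‖) :
    (StronglySemismoothOn (metricProjection (subdifferential p 0)) Set.univ →
      ∀ (xbar : EuclideanSpace ℝ (Fin n)) (lbar : ℝ), 0 < lbar →
        proxResidual p A b (xbar, lbar) = 0 →
        IsNondegenerate (partialClarkeJacobian (proxResidual p A b) (xbar, lbar)) →
        StronglySemismoothAt y (Set.Ioi 0) lbar ∧ StronglySemismoothAt φ (Set.Ioi 0) lbar) ∧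
    (IsPolyhedralFunction p →
      IsPiecewiseAffineOn y (Set.Ioi 0) ∧ StronglySemismoothOn φ (Set.Ioi 0)) := by
  have hne : (subdifferential p 0).Nonempty := ⟨0, hp.zero_mem_subdifferential⟩
  have hcl := hp.isClosed_subdifferential
  have hconv := hp.convex_subdifferential
  have hmin := fun l hl => exists_epigraph_minimizer hp hl (hx l hl)
  have hK : ∀ l : ℝ, 0 < l → IsKKTPoint (subdifferential p 0) (euclideanCLM A) b (x l) l :=
    fun l hl => by
      obtain ⟨s, hs, hs'⟩ := hmin l hl
      exact isKKTPoint_of_epigraph_minimizer hp hl hs hs'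
  have hy : ∀ l : ℝ, 0 < l → y l = b - euclideanCLM A (x l) :=
    fun l hl => dual_solution_eq hp hl (hK l hl) (hyu l hl)
  have hylip : LocallyLipschitzOn (Set.Ioi 0) y :=
    IsKKTPoint.locallyLipschitzOn hp.zero_mem_subdifferential hK hy
  have hφy : ∀ l : ℝ, 0 < l → φ l = ‖y l‖ := fun l hl => by
    rw [hφ l hl, hy l hl, norm_sub_rev, toEuclideanLin_apply_eq]
  have hφlip : LocallyLipschitzOn (Set.Ioi 0) φ := by
    intro l hl
    obtain ⟨K, t, ht, hKt⟩ := hylip.norm hl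
    refine ⟨K, t ∩ Set.Ioi 0, Filter.inter_mem ht self_mem_nhdsWithin, fun r hr q hq => ?_⟩
    rw [hφy r hr.2, hφy q hq.2]
    exact hKt hr.1 hq.1
  -- Common endpoint of both parts: only the quotients of `y` remain to be controlled.
  have hslope : ∀ l : ℝ, 0 < l → HasLipschitzSlopeAt y l →
      StronglySemismoothAt y (Set.Ioi 0) l ∧ StronglySemismoothAt φ (Set.Ioi 0) l := by
    intro l hl h
    refine ⟨h.stronglySemismoothAt isOpen_Ioi hl hylip,
      HasLipschitzSlopeAt.stronglySemismoothAt isOpen_Ioi hl hφlip ?_⟩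
    refine h.norm.congr ?_
    filter_upwards [eventually_gt_nhds hl] with r hr using hφy r hr
  refine ⟨fun hP xbar lbar hlbar hzero hnd => ?_, fun hpoly => ?_⟩
  · rw [proxResidual_eq hp hp_closed] at hzero hnd
    have h₀ := (projectionResidual_eq_zero_iff hne hcl hconv).1 hzero
    have hs := hasLipschitzSlopeAt_path hne hcl hconv hP hlbar h₀ hnd hK
    refine hslope lbar hlbar (hs.const_sub_clm (euclideanCLM A) b (hy lbar hlbar) ?_)
    filter_upwards [eventually_gt_nhds hlbar] with l hl using hy l hl
  · choose! s hs hs' using hmin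
    have hpa : IsPiecewiseAffineOn y (Set.Ioi 0) :=
      isPiecewiseAffineOn_residual hpoly hs hs' hy hylip.continuousOn
    exact ⟨hpa, fun l hl => (hslope l hl (hpa.hasLipschitzSlopeAt isOpen_Ioi hl)).2⟩
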